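/- **Theorem 2 (Horizontal Collapsing Property).** Let $K\subset\mathbf R^n$ be a union of finitely many pairwise disjoint simple closed curves of class $C^3$ (the components of $K$), each parametrized by arclength $s$ as a periodic $C^3$ curve $\gamma:\mathbf R\to\mathbf R^n$ whose minimal period $L$ is the length of the component, and let $\mu:K\to(0,\infty)$ be of class $C^3$; write $\mu(s)=\mu(\gamma(s))$, $\kappa(s)=\|\gamma''(s)\|$, and $N_\gamma(s)=\gamma''(s)/\kappa(s)$ where $\kappa(s)>0$. Let $\operatorname{grad}\mu(\gamma(s))=\mu'(s)\gamma'(s)$, let $UNK_q$ be the set of unit vectors normal to $K$ at $q$, and for $q\in K$ and $w$ normal to $K$ at $q$ with $\|w\|\,\|\operatorname{grad}\mu(q)\|\le 1$ put $$\exp^\mu(q,w)=q-\mu(q)\|w\|^2\operatorname{grad}\mu(q)+\mu(q)\sqrt{1-\|\operatorname{grad}\mu(q)\|^2\|w\|^2}\;w .$$ Let $\tfrac12 DCSD(K,\mu)$ be the minimum of $\|x-y\|/(\mu(x)+\mu(y))$ over all pairs $(x,y)\in K\times K$ with $x\ne y$ that are critical for $\Sigma(x,y)=\|x-y\|^2(\mu(x)+\mu(y))^{-2}$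 on $K\times K$. For a component parametrized by $\gamma$ let $$FocRad^-=\Bigl(\max\Bigl[\sup\bigl\{\tfrac12(\mu^2)''+\tfrac12\kappa^2\mu^2+\kappa\mu\sqrt{\mu(\mu''+\tfrac14\kappa^2\mu)}\;:\;\mu''+\tfrac14\kappa^2\mu>0\bigr\},\ \max|\mu'|^2\Bigr]\Bigr)^{-1/2},$$ let $FocRad^-(K,\mu)$ be the minimum of these numbers over the components, and let $UR(K,\mu)=\min\bigl(\tfrac12DCSD(K,\mu),FocRad^-(K,\mu)\bigr)$. Assume that $q_1,q_2\in K$, $v_i\in UNK_{q_i}$, $0\le r_1,r_2<UR(K,\mu)$, $(q_1,r_1v_1)\neq(q_2,r_2v_2)$ and $\exp^\mu(q_1,r_1v_1)=\exp^\mu(q_2,r_2v_2)=p_0$. Then: (i) $q_1\ne q_2$, and $q_1,q_2$ belong to the same component $K_1$ of $K$. (ii) $r_1=r_2>0$. Let $\gamma$ be a unit speed parametrization of $K_1$ as above, of period $L$, and let $q_i=\gamma(s_i)$ with $s_1<s_2<s_1+L$. Then $\kappa(s_i)>0$ and $v_i=N_\gamma(s_i)$ for $i=1,2$, and for $I=[s_1,s_2]$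 or for $I=[s_2-L,s_1]$ one has $\kappa(s)>0$ and $\exp^\mu(\gamma(s),r_1N_\gamma(s))=p_0$ for all $s\in I$. (iii) On this interval $I$, $\kappa$ is a positive constant and $$(\mu')^2-\mu\mu''=\frac1{r_1^2},\qquad \gamma'''+\kappa^2\gamma'=0,\qquad \mu(s)=\frac{2}{\kappa r_1}\cos\Bigl(\frac{\kappa s}{2}+a\Bigr)\ \text{ for some } a\in\mathbf R,$$ and $\gamma$ is an arc of a circle of radius $1/\kappa$: $\gamma(s)=c+\frac1\kappa(\cos(\kappa s)e_1+\sin(\kappa s)e_2)$ on $I$ for some $c\in\mathbf R^n$ and orthonormal $e_1,e_2\in\mathbf R^n$. Moreover $\gamma(I)\ne K_1$, and even $\gamma(J)\neq K_1$ for every interval $J\supseteq I$ on which $\kappa>0$ and $\exp^\mu(\gamma(s),r_1N_\gamma(s))=p_0$. -/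

import Mathlib

open scoped ENNReal

/-- A union of finitely many pairwise disjoint simple closed `C³` curves in `ℝⁿ` (its components,
each given by a periodic arclength parametrization `γ i` whose period `L i` is its length),
together with a positive `C³` weight on it. Only the values of `μ` at points of the curves matter. -/
structure WeightedLink (n : ℕ) where
  /-- number of components -/
  m : ℕ
  /-- arclength parametrizations of the components -/
  γ : Fin m → ℝ → EuclideanSpace ℝ (Fin n)
  /-- lengths of the components -/
  L : Fin m → ℝ
  /-- the weight -/
  μ : EuclideanSpace ℝ (Fin n) → ℝ
  L_pos : ∀ i, 0 < L i
  contDiff_γ : ∀ i, ContDiff ℝ 3 (γ i)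
  unit_speed : ∀ i s, ‖deriv (γ i) s‖ = 1
  periodic : ∀ i, Function.Periodic (γ i) (L i)
  simple : ∀ i, Set.InjOn (γ i) (Set.Ico 0 (L i))
  disjoint : ∀ i j, i ≠ j → Disjoint (Set.range (γ i)) (Set.range (γ j))
  μ_pos : ∀ i s, 0 < μ (γ i s)
  contDiff_μ : ∀ i, ContDiff ℝ 3 (fun s => μ (γ i s))

noncomputable section

namespace WeightedLink

variable {n : ℕ} (K : WeightedLink n)

/-- The `i`-th component, as a subset of `ℝⁿ`. -/
def component (i : Fin K.m) : Set (EuclideanSpace ℝ (Fin n)) := Set.range (K.γ i)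

/-- The underlying set of the link. -/
def carrier : Set (EuclideanSpace ℝ (Fin n)) := ⋃ i, K.component i

/-- The weight along the `i`-th component as a function of arclength. -/
def w (i : Fin K.m) (s : ℝ) : ℝ := K.μ (K.γ i s)

/-- Curvature of the `i`-th component. -/
def κ (i : Fin K.m) (s : ℝ) : ℝ := ‖iteratedDeriv 2 (K.γ i) s‖

/-- Principal normal `γ'' / κ` of the `i`-th component (meaningful where `κ > 0`). -/
def N (i : Fin K.m) (s : ℝ) : EuclideanSpace ℝ (Fin n) :=
  (K.κ i s)⁻¹ • iteratedDeriv 2 (K.γ i) s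

open Classical in
/-- The intrinsic gradient of the weight along the link: `μ'(s) γ'(s)` at the point `γ(s)`
(independent of the chosen parameter, see `grad_γ`). -/
def grad (q : EuclideanSpace ℝ (Fin n)) : EuclideanSpace ℝ (Fin n) :=
  if h : ∃ x : Fin K.m × ℝ, K.γ x.1 x.2 = q then
    deriv (K.w h.choose.1) h.choose.2 • deriv (K.γ h.choose.1) h.choose.2
  else 0

/-- The unit normal vectors to the link at `q`. -/
def unitNormals (q : EuclideanSpace ℝ (Fin n)) : Set (EuclideanSpace ℝ (Fin n)) :=
  {v | ‖v‖ = 1 ∧ ∀ i s, K.γ i s = q → inner ℝ (deriv (K.γ i) s) v = 0}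

/-- The weighted exponential map; it is used only for `q` on the link, `v` normal to the link at
`q`, and `‖v‖ ‖grad μ(q)‖ ≤ 1`. -/
def expMu (q v : EuclideanSpace ℝ (Fin n)) : EuclideanSpace ℝ (Fin n) :=
  q - (K.μ q * ‖v‖ ^ 2) • K.grad q
    + (K.μ q * Real.sqrt (1 - ‖K.grad q‖ ^ 2 * ‖v‖ ^ 2)) • v

/-- `Σ(x, y) = ‖x - y‖² (μ(x) + μ(y))⁻²`. -/
def Sig (x y : EuclideanSpace ℝ (Fin n)) : ℝ := ‖x - y‖ ^ 2 / (K.μ x + K.μ y) ^ 2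

/-- Double critical pairs: distinct points of the link at which both partial derivatives of `Σ`
with respect to arclength vanish. -/
def IsDoubleCriticalPair (x y : EuclideanSpace ℝ (Fin n)) : Prop :=
  x ≠ y ∧ ∃ i s j t, K.γ i s = x ∧ K.γ j t = y ∧
    deriv (fun a => K.Sig (K.γ i a) (K.γ j t)) s = 0 ∧
    deriv (fun b => K.Sig (K.γ i s) (K.γ j b)) t = 0

/-- Half of the double critical self distance. -/
def halfDCSD : ℝ≥0∞ :=
  ⨅ (x : EuclideanSpace ℝ (Fin n)) (y : EuclideanSpace ℝ (Fin n))
    (_ : K.IsDoubleCriticalPair x y), ENNReal.ofReal (‖x - y‖ / (K.μ x + K.μ y))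

/-- `μ'' + κ² μ / 4`. -/
def Del (i : Fin K.m) (s : ℝ) : ℝ :=
  iteratedDeriv 2 (K.w i) s + 1 / 4 * K.κ i s ^ 2 * K.w i s

/-- `(μ²)'' / 2 + κ² μ² / 2 + κ μ √(μ (μ'' + κ² μ / 4))`; it is nonnegative where
`μ'' + κ² μ / 4 ≥ 0`. -/
def Lam (i : Fin K.m) (s : ℝ) : ℝ :=
  1 / 2 * iteratedDeriv 2 (fun t => K.w i t ^ 2) s + 1 / 2 * K.κ i s ^ 2 * K.w i s ^ 2
    + K.κ i s * K.w i s * Real.sqrt (K.w i s * K.Del i s)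

/-- The focal radius `FocRad⁻` of the `i`-th component. -/
def focRadMinusComp (i : Fin K.m) : ℝ≥0∞ :=
  (max (⨆ (s : ℝ) (_ : 0 < K.Del i s), ENNReal.ofReal (K.Lam i s))
    (⨆ s : ℝ, ENNReal.ofReal (deriv (K.w i) s ^ 2))) ^ (-(1 / 2) : ℝ)

/-- The focal radius `FocRad⁻` of the link. -/
def focRadMinus : ℝ≥0∞ := ⨅ i, K.focRadMinusComp i

/-- The upper radius `UR`. -/
def UR : ℝ≥0∞ := min K.halfDCSD K.focRadMinus

theorem exists_eq_add_of_γ_eq {i j : Fin K.m} {s t : ℝ} (h : K.γ i s = K.γ j t) :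
    i = j ∧ ∃ k : ℤ, s = t + k * K.L i := by
  have hij : i = j := by
    by_contra hne
    exact Set.disjoint_left.mp (K.disjoint i j hne) ⟨s, rfl⟩ ⟨t, h.symm⟩
  subst hij
  refine ⟨rfl, ?_⟩
  obtain ⟨a, ha, -⟩ := existsUnique_add_zsmul_mem_Ico (K.L_pos i) s 0
  obtain ⟨b, hb, -⟩ := existsUnique_add_zsmul_mem_Ico (K.L_pos i) t 0
  rw [zero_add] at ha hb
  have e := K.simple i ha hb
    (by rw [(K.periodic i).zsmul a s, (K.periodic i).zsmul b t]; exact h)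
  refine ⟨b - a, ?_⟩
  simp only [zsmul_eq_mul] at e
  push_cast
  linarith

theorem grad_γ (i : Fin K.m) (s : ℝ) :
    K.grad (K.γ i s) = deriv (K.w i) s • deriv (K.γ i) s := by
  have h : ∃ x : Fin K.m × ℝ, K.γ x.1 x.2 = K.γ i s := ⟨(i, s), rfl⟩
  have hper : ∀ {F : Type} [NormedAddCommGroup F] [NormedSpace ℝ F] (f : ℝ → F) (c : ℝ),
      Function.Periodic f c → Function.Periodic (deriv f) c := by
    intro F _ _ f c hf x
    rw [← deriv_comp_add_const]
    congr 1
    exact funext hf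
  rw [grad, dif_pos h]
  have hx := h.choose_spec
  generalize h.choose = x at hx
  obtain ⟨j, t⟩ := x
  obtain ⟨hji, k, hk⟩ := K.exists_eq_add_of_γ_eq hx
  simp only at hji hk
  subst hji
  have hw : Function.Periodic (K.w j) (K.L j) := fun x => by rw [w, w, K.periodic j x]
  have h1 := (hper (K.w j) _ hw).zsmul k s
  have h2 := (hper (K.γ j) _ (K.periodic j)).zsmul k s
  rw [zsmul_eq_mul, ← hk] at h1 h2
  simp only [h1, h2]

end WeightedLink

end

/-! For a point `p` and a component, consider the squared weighted distance F(s) = ‖γ(s) - p‖² /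
μ(s)², called `distRatio`. If p = exp^μ(γ(s), r v), then F(s) = r² and F'(s) = 0, so the hypothesis
supplies two critical points of weighted distances to `p₀`, both with values below UR².

Focal part. Write κ for the curvature and let R lie below the focal radius. Where F ≤ R²,
Cauchy–Schwarz bounds the Hessian below by (√(1 - μ'²F) - ½κμ√F)² - Fμ(μ'' + ¼κ²μ), up to a multiple
of |F'|, and this expression is nonnegative by the definition of FocRad⁻ (`focal_quadratic`,
`distRatioHess_ge`). Hence F'' ≥ -C|F'| on compact intervals. This is enough for quasiconvexity
(`distRatio_le_max`) and makes F' vanish between two of its zeros (`distRatioDeriv_eq_zero`), as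
long as the arc stays in {F ≤ R²}.

Global part. One of the two arcs between the points does stay in {F ≤ R²}. For `p` replaced by the
point of the chord that divides it in the ratio of the weights, a pair violating this and minimizing
Σ among violating pairs would be a local minimum of Σ, hence a double critical pair below ½DCSD
(`joined_segPoint`). A continuity argument moves `p` within the convex intersection of the two balls
(`Joined.of_mem`). Distinct components are excluded by minimizing Σ over the whole torus
(`eq_of_Sig_le`).

Rigidity. On the resulting arc F is constant and the Hessian vanishes, so all the inequalities are
equalities: μ'' = -¼κ²μ, and `p` lies in the osculating plane on the side of γ''
(`degenerate_critical`). Differentiating these identities makes κ constant, γ circular and μ a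
cosine (`critical_arc`). Since μ'' < 0 along the arc, it misses a minimum of μ and cannot cover the
component. -/

/-! ### Differential inequalities in one variable -/

/-- A function that satisfies `f' ≥ -C |f|` stays positive once it is positive. -/
theorem pos_of_neg_mul_abs_le_deriv {f f' : ℝ → ℝ} {C a b : ℝ}
    (hf : ∀ s ∈ Set.Icc a b, HasDerivAt f (f' s) s)
    (h : ∀ s ∈ Set.Icc a b, -(C * |f s|) ≤ f' s) (ha : 0 < f a) :
    ∀ s ∈ Set.Icc a b, 0 < f s := by
  -- The barrier decays at rate C + 1 instead of C, so that the derivative comparison is strict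
  -- where `f` meets it.
  have hB : ∀ s, HasDerivAt (fun s => -(f a * Real.exp (-(C + 1) * (s - a))))
      ((C + 1) * (f a * Real.exp (-(C + 1) * (s - a)))) s := fun s => by
    have h1 : HasDerivAt (fun s => -(C + 1) * (s - a)) (-(C + 1)) s := by
      simpa using ((hasDerivAt_id s).sub_const a).const_mul (-(C + 1))
    refine (h1.exp.const_mul (f a)).neg.congr_deriv ?_
    ring
  have key : ∀ ⦃s⦄, s ∈ Set.Icc a b → -f s ≤ -(f a * Real.exp (-(C + 1) * (s - a))) := by
    refine image_le_of_deriv_right_lt_deriv_boundary' (f := fun s => -f s) (f' := fun s => -f' s)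
      (fun s hs => (hf s hs).continuousAt.neg.continuousWithinAt)
      (fun s hs => (hf s ⟨hs.1, hs.2.le⟩).neg.hasDerivWithinAt) (by simp)
      (fun s _ => (hB s).continuousAt.continuousWithinAt)
      (fun s _ => (hB s).hasDerivWithinAt) ?_
    intro s hs he
    have h1 := h s ⟨hs.1, hs.2.le⟩
    have h2 : f s = f a * Real.exp (-(C + 1) * (s - a)) := by linarith
    have h3 : 0 < f s := by rw [h2]; positivity
    rw [abs_of_pos h3] at h1
    rw [← h2]
    linarith
  intro s hs
  have h1 := key hs
  have h2 : 0 < f a * Real.exp (-(C + 1) * (s - a)) := by positivity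
  linarith

/-- A function that satisfies `f' ≥ -C |f|` was negative before it is negative. -/
theorem neg_of_neg_mul_abs_le_deriv {f f' : ℝ → ℝ} {C a b : ℝ}
    (hf : ∀ s ∈ Set.Icc a b, HasDerivAt f (f' s) s)
    (h : ∀ s ∈ Set.Icc a b, -(C * |f s|) ≤ f' s) (hb : f b < 0) :
    ∀ s ∈ Set.Icc a b, f s < 0 := by
  have hmem : ∀ s ∈ Set.Icc (-b) (-a), -s ∈ Set.Icc a b := fun s hs =>
    ⟨by linarith [hs.2], by linarith [hs.1]⟩
  have key := pos_of_neg_mul_abs_le_deriv (f := fun s => -f (-s)) (f' := fun s => f' (-s))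
    (C := C) (a := -b) (b := -a)
    (fun s hs => by
      refine ((hf (-s) (hmem s hs)).comp s (hasDerivAt_neg s)).neg.congr_deriv ?_
      ring)
    (fun s hs => by simpa using h (-s) (hmem s hs)) (by simpa using hb)
  intro s hs
  have := key (-s) ⟨by linarith [hs.2], by linarith [hs.1]⟩
  simpa using this

/-- If `F'' ≥ -C |F'|` on an interval then `F` is at most the maximum of its end values. -/
theorem le_max_of_neg_mul_abs_deriv_le {F F' F'' : ℝ → ℝ} {C a b : ℝ}
    (hF : ∀ s ∈ Set.Icc a b, HasDerivAt F (F' s) s)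
    (hF' : ∀ s ∈ Set.Icc a b, HasDerivAt F' (F'' s) s)
    (h : ∀ s ∈ Set.Icc a b, -(C * |F' s|) ≤ F'' s) :
    ∀ s ∈ Set.Icc a b, F s ≤ max (F a) (F b) := by
  intro u hu
  by_contra! hlt
  obtain ⟨h1, h2⟩ := max_lt_iff.mp hlt
  have hau : a < u := lt_of_le_of_ne hu.1 (by rintro rfl; exact lt_irrefl _ h1)
  have hub : u < b := lt_of_le_of_ne hu.2 (by rintro rfl; exact lt_irrefl _ h2)
  -- An interior value above both ends gives a point with F' > 0 followed by one with F' < 0, which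
  -- the persistence of positivity forbids.
  obtain ⟨c, hc, hce⟩ := exists_hasDerivAt_eq_slope F F' hau
    (fun s hs => (hF s ⟨hs.1, hs.2.trans hu.2⟩).continuousAt.continuousWithinAt)
    (fun s hs => hF s ⟨hs.1.le, hs.2.le.trans hu.2⟩)
  obtain ⟨d, hd, hde⟩ := exists_hasDerivAt_eq_slope F F' hub
    (fun s hs => (hF s ⟨hu.1.trans hs.1, hs.2⟩).continuousAt.continuousWithinAt)
    (fun s hs => hF s ⟨hu.1.trans hs.1.le, hs.2.le⟩)
  have hc0 : 0 < F' c := by rw [hce]; exact div_pos (by linarith) (by linarith)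
  have hd0 : F' d < 0 := by rw [hde]; exact div_neg_of_neg_of_pos (by linarith) (by linarith)
  have hsub : ∀ s ∈ Set.Icc c b, s ∈ Set.Icc a b := fun s hs => ⟨hc.1.le.trans hs.1, hs.2⟩
  have := pos_of_neg_mul_abs_le_deriv (fun s hs => hF' s (hsub s hs))
    (fun s hs => h s (hsub s hs)) hc0 d ⟨hc.2.le.trans hd.1.le, hd.2.le⟩
  linarith

/-- If `F'' ≥ -C |F'|` then `F'` vanishes between any two of its zeros. -/
theorem deriv_eq_zero_of_neg_mul_abs_deriv_le {F' F'' : ℝ → ℝ} {C a b : ℝ}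
    (hF' : ∀ s ∈ Set.Icc a b, HasDerivAt F' (F'' s) s)
    (h : ∀ s ∈ Set.Icc a b, -(C * |F' s|) ≤ F'' s) (ha : F' a = 0) (hb : F' b = 0) :
    ∀ s ∈ Set.Icc a b, F' s = 0 := by
  intro u hu
  rcases lt_trichotomy (F' u) 0 with hlt | heq | hgt
  · have hsub : ∀ s ∈ Set.Icc a u, s ∈ Set.Icc a b := fun s hs => ⟨hs.1, hs.2.trans hu.2⟩
    have := neg_of_neg_mul_abs_le_deriv (fun s hs => hF' s (hsub s hs))
      (fun s hs => h s (hsub s hs)) hlt a ⟨le_rfl, hu.1⟩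
    linarith
  · exact heq
  · have hsub : ∀ s ∈ Set.Icc u b, s ∈ Set.Icc a b := fun s hs => ⟨hu.1.trans hs.1, hs.2⟩
    have := pos_of_neg_mul_abs_le_deriv (fun s hs => hF' s (hsub s hs))
      (fun s hs => h s (hsub s hs)) hgt b ⟨hu.2, le_rfl⟩
    linarith

/-! ### The weighted distance from a point and its derivatives -/

noncomputable section

namespace WeightedLink

variable {n : ℕ} (K : WeightedLink n)

theorem hasDerivAt_γ (i : Fin K.m) (s : ℝ) : HasDerivAt (K.γ i) (deriv (K.γ i) s) s :=
  ((K.contDiff_γ i).differentiable (by norm_num) s).hasDerivAt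

theorem hasDerivAt_deriv_γ (i : Fin K.m) (s : ℝ) :
    HasDerivAt (deriv (K.γ i)) (iteratedDeriv 2 (K.γ i) s) s := by
  have h := (((K.contDiff_γ i).differentiable_iteratedDeriv 1 (by norm_num)) s).hasDerivAt
  rwa [← iteratedDeriv_succ, iteratedDeriv_one] at h

theorem hasDerivAt_iteratedDeriv_two_γ (i : Fin K.m) (s : ℝ) :
    HasDerivAt (iteratedDeriv 2 (K.γ i)) (iteratedDeriv 3 (K.γ i) s) s := by
  have h := (((K.contDiff_γ i).differentiable_iteratedDeriv 2 (by norm_num)) s).hasDerivAt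
  rwa [← iteratedDeriv_succ] at h

theorem contDiff_w (i : Fin K.m) : ContDiff ℝ 3 (K.w i) := K.contDiff_μ i

theorem w_pos (i : Fin K.m) (s : ℝ) : 0 < K.w i s := K.μ_pos i s

theorem hasDerivAt_w (i : Fin K.m) (s : ℝ) : HasDerivAt (K.w i) (deriv (K.w i) s) s :=
  ((K.contDiff_w i).differentiable (by norm_num) s).hasDerivAt

theorem hasDerivAt_deriv_w (i : Fin K.m) (s : ℝ) :
    HasDerivAt (deriv (K.w i)) (iteratedDeriv 2 (K.w i) s) s := by
  have h := (((K.contDiff_w i).differentiable_iteratedDeriv 1 (by norm_num)) s).hasDerivAt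
  rwa [← iteratedDeriv_succ, iteratedDeriv_one] at h

theorem hasDerivAt_iteratedDeriv_two_w (i : Fin K.m) (s : ℝ) :
    HasDerivAt (iteratedDeriv 2 (K.w i)) (iteratedDeriv 3 (K.w i) s) s := by
  have h := (((K.contDiff_w i).differentiable_iteratedDeriv 2 (by norm_num)) s).hasDerivAt
  rwa [← iteratedDeriv_succ] at h

theorem continuous_γ (i : Fin K.m) : Continuous (K.γ i) := (K.contDiff_γ i).continuous

theorem continuous_w (i : Fin K.m) : Continuous (K.w i) := (K.contDiff_w i).continuous

theorem continuous_deriv_w (i : Fin K.m) : Continuous (deriv (K.w i)) :=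
  continuous_iff_continuousAt.mpr fun s => (K.hasDerivAt_deriv_w i s).continuousAt

theorem continuous_κ (i : Fin K.m) : Continuous (K.κ i) :=
  (continuous_iff_continuousAt.mpr fun s =>
    (K.hasDerivAt_iteratedDeriv_two_γ i s).continuousAt).norm

theorem w_periodic (i : Fin K.m) : Function.Periodic (K.w i) (K.L i) := fun s => by
  rw [w, w, K.periodic i s]

theorem κ_nonneg (i : Fin K.m) (s : ℝ) : 0 ≤ K.κ i s := norm_nonneg _

theorem inner_deriv_γ_self (i : Fin K.m) (s : ℝ) :
    inner ℝ (deriv (K.γ i) s) (deriv (K.γ i) s) = 1 := by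
  rw [real_inner_self_eq_norm_sq, K.unit_speed i s, one_pow]

theorem inner_deriv_γ_iteratedDeriv_two (i : Fin K.m) (s : ℝ) :
    inner ℝ (deriv (K.γ i) s) (iteratedDeriv 2 (K.γ i) s) = 0 := by
  have h := (K.hasDerivAt_deriv_γ i s).inner ℝ (K.hasDerivAt_deriv_γ i s)
  have h0 : (fun t => inner ℝ (deriv (K.γ i) t) (deriv (K.γ i) t)) = fun _ => (1 : ℝ) :=
    funext fun t => K.inner_deriv_γ_self i t
  rw [h0] at h
  have := h.unique (hasDerivAt_const s (1 : ℝ))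
  rw [real_inner_comm (deriv (K.γ i) s)] at this
  linarith

theorem iteratedDeriv_two_w_sq (i : Fin K.m) (s : ℝ) :
    iteratedDeriv 2 (fun t => K.w i t ^ 2) s
      = 2 * (deriv (K.w i) s ^ 2 + K.w i s * iteratedDeriv 2 (K.w i) s) := by
  have h1 : deriv (fun t => K.w i t ^ 2) = fun t => 2 * (K.w i t * deriv (K.w i) t) := by
    funext t
    have := ((K.hasDerivAt_w i t).pow 2).deriv
    simp only [Nat.cast_ofNat, Nat.add_one_sub_one, pow_one] at this
    rw [← mul_assoc]
    exact this
  rw [show (2 : ℕ) = 1 + 1 from rfl, iteratedDeriv_succ, iteratedDeriv_one, h1]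
  have := (((K.hasDerivAt_w i s).mul (K.hasDerivAt_deriv_w i s)).const_mul 2).deriv
  refine Eq.trans this ?_
  ring

/-- The squared weighted distance `‖γ(s) - p‖² / μ(s)²` from `p` to the `i`-th component. -/
def distRatio (i : Fin K.m) (p : EuclideanSpace ℝ (Fin n)) (s : ℝ) : ℝ :=
  ‖K.γ i s - p‖ ^ 2 / K.w i s ^ 2

/-- The derivative of `distRatio`. -/
def distRatioDeriv (i : Fin K.m) (p : EuclideanSpace ℝ (Fin n)) (s : ℝ) : ℝ :=
  (2 * inner ℝ (K.γ i s - p) (deriv (K.γ i) s)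
    - 2 * K.distRatio i p s * K.w i s * deriv (K.w i) s) / K.w i s ^ 2

/-- Half the second derivative of `‖γ - p‖² - r² μ²` at a parameter where the weighted distance
from `p` is `r`. -/
def distRatioHess (i : Fin K.m) (p : EuclideanSpace ℝ (Fin n)) (s : ℝ) : ℝ :=
  1 + inner ℝ (K.γ i s - p) (iteratedDeriv 2 (K.γ i) s)
    - K.distRatio i p s * (deriv (K.w i) s ^ 2 + K.w i s * iteratedDeriv 2 (K.w i) s)

theorem distRatio_nonneg (i : Fin K.m) (p : EuclideanSpace ℝ (Fin n)) (s : ℝ) :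
    0 ≤ K.distRatio i p s := by
  unfold distRatio; positivity

theorem norm_sub_sq_eq (i : Fin K.m) (p : EuclideanSpace ℝ (Fin n)) (s : ℝ) :
    ‖K.γ i s - p‖ ^ 2 = K.distRatio i p s * K.w i s ^ 2 := by
  have := K.w_pos i s
  unfold distRatio; field_simp

theorem inner_sub_deriv_γ (i : Fin K.m) (p : EuclideanSpace ℝ (Fin n)) (s : ℝ) :
    inner ℝ (K.γ i s - p) (deriv (K.γ i) s)
      = K.distRatio i p s * K.w i s * deriv (K.w i) s
        + 1 / 2 * K.w i s ^ 2 * K.distRatioDeriv i p s := by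
  have := K.w_pos i s
  unfold distRatioDeriv; field_simp; ring

theorem hasDerivAt_distRatio (i : Fin K.m) (p : EuclideanSpace ℝ (Fin n)) (s : ℝ) :
    HasDerivAt (K.distRatio i p) (K.distRatioDeriv i p s) s := by
  have hw := K.w_pos i s
  have h1 := ((K.hasDerivAt_γ i s).sub_const p).norm_sq
  have h2 := (K.hasDerivAt_w i s).pow 2
  refine (h1.div h2 (pow_pos hw 2).ne').congr_deriv ?_
  rw [distRatioDeriv, Pi.pow_apply, K.norm_sub_sq_eq]
  field_simp
  push_cast
  ring

theorem hasDerivAt_distRatioDeriv (i : Fin K.m) (p : EuclideanSpace ℝ (Fin n)) (s : ℝ) :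
    HasDerivAt (K.distRatioDeriv i p)
      ((2 * K.distRatioHess i p s
        - 4 * K.w i s * deriv (K.w i) s * K.distRatioDeriv i p s) / K.w i s ^ 2) s := by
  have hw := K.w_pos i s
  have h1 := (((K.hasDerivAt_γ i s).sub_const p).inner ℝ (K.hasDerivAt_deriv_γ i s)).const_mul 2
  have h2 := ((((K.hasDerivAt_distRatio i p s).const_mul 2).mul (K.hasDerivAt_w i s)).mul
    (K.hasDerivAt_deriv_w i s))
  have h3 := (K.hasDerivAt_w i s).pow 2
  refine ((h1.sub h2).div h3 (pow_pos hw 2).ne').congr_deriv ?_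
  simp only [Pi.mul_apply, Pi.pow_apply, Pi.sub_apply]
  rw [K.inner_sub_deriv_γ, K.inner_deriv_γ_self, distRatioHess]
  field_simp
  push_cast
  ring

/-- `R` is less than the focal radius of the `i`-th component, in terms of real numbers. -/
def SubFocal (i : Fin K.m) (R : ℝ) : Prop :=
  0 ≤ R ∧ ∀ s, R ^ 2 * deriv (K.w i) s ^ 2 < 1 ∧ (0 < K.Del i s → R ^ 2 * K.Lam i s < 1)

end WeightedLink
end

/-! ### The Hessian bound below the focal radius -/

noncomputable section

namespace WeightedLink

variable {n : ℕ} (K : WeightedLink n)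

theorem sq_mul_lt_one_of_ofReal_lt {R c : ℝ} {X : ℝ≥0∞} (hR : 0 ≤ R)
    (h : ENNReal.ofReal R < X ^ (-(1 / 2) : ℝ)) (hc : ENNReal.ofReal c ≤ X) : R ^ 2 * c < 1 := by
  rcases hR.eq_or_lt with rfl | hR
  · simp
  by_contra! h1
  have h2 : (R ^ 2)⁻¹ ≤ c := by
    rw [inv_le_iff_one_le_mul₀ (by positivity)]; linarith
  have h3 : ENNReal.ofReal ((R ^ 2)⁻¹) ≤ X := (ENNReal.ofReal_le_ofReal h2).trans hc
  have h4 : X ^ (-(1 / 2) : ℝ) ≤ ENNReal.ofReal ((R ^ 2)⁻¹) ^ (-(1 / 2) : ℝ) := by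
    rw [ENNReal.rpow_neg, ENNReal.rpow_neg, ENNReal.inv_le_inv]
    exact ENNReal.rpow_le_rpow h3 (by norm_num)
  have h5 : ENNReal.ofReal ((R ^ 2)⁻¹) ^ (-(1 / 2) : ℝ) = ENNReal.ofReal R := by
    rw [ENNReal.ofReal_rpow_of_pos (by positivity)]
    congr 1
    rw [Real.inv_rpow (by positivity), Real.rpow_neg (by positivity), inv_inv,
      ← Real.sqrt_eq_rpow, Real.sqrt_sq hR.le]
  rw [h5] at h4
  exact absurd h (not_lt.mpr h4)

theorem subFocal_of_lt_focRadMinus {R : ℝ} (hR : 0 ≤ R)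
    (h : ENNReal.ofReal R < K.focRadMinus) (i : Fin K.m) : K.SubFocal i R := by
  have h1 : ENNReal.ofReal R < K.focRadMinusComp i := h.trans_le (iInf_le _ i)
  refine ⟨hR, fun s => ⟨sq_mul_lt_one_of_ofReal_lt hR h1 ?_, fun hs =>
    sq_mul_lt_one_of_ofReal_lt hR h1 ?_⟩⟩
  · exact le_max_of_le_right (le_iSup (fun s => ENNReal.ofReal (deriv (K.w i) s ^ 2)) s)
  · exact le_max_of_le_left
      (le_iSup₂ (f := fun s (_ : 0 < K.Del i s) => ENNReal.ofReal (K.Lam i s)) s hs)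

/-- Where μ'' + ¼κ²μ ≥ 0 the last two terms cancel and Λ becomes a sum of two squares, the form in
which the focal bound can be compared with the quadratic of `focal_quadratic`. -/
theorem Lam_eq (i : Fin K.m) (s : ℝ) :
    K.Lam i s = deriv (K.w i) s ^ 2
      + (1 / 2 * K.κ i s * K.w i s + Real.sqrt (K.w i s * K.Del i s)) ^ 2
      + K.w i s * K.Del i s - Real.sqrt (K.w i s * K.Del i s) ^ 2 := by
  rw [Lam, K.iteratedDeriv_two_w_sq, Del]
  ring

/-- Below the focal radius the quadratic polynomial that bounds the Hessian is nonnegative, and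
it vanishes only where `μ'' + κ² μ / 4 = 0`. -/
theorem focal_quadratic (i : Fin K.m) {R F s : ℝ} (hR : K.SubFocal i R) (hF₀ : 0 ≤ F)
    (hF : F ≤ R ^ 2) :
    0 ≤ (√(1 - deriv (K.w i) s ^ 2 * F) - 1 / 2 * K.κ i s * K.w i s * √F) ^ 2
        - F * (K.w i s * K.Del i s) ∧
    ((√(1 - deriv (K.w i) s ^ 2 * F) - 1 / 2 * K.κ i s * K.w i s * √F) ^ 2
        - F * (K.w i s * K.Del i s) = 0 →
      K.Del i s = 0 ∧ √(1 - deriv (K.w i) s ^ 2 * F) = 1 / 2 * K.κ i s * K.w i s * √F ∧ 0 < F) := by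
  obtain ⟨-, h⟩ := hR
  obtain ⟨h1, h2⟩ := h s
  have hw := K.w_pos i s
  have hκ := K.κ_nonneg i s
  have hx0 : 0 < 1 - deriv (K.w i) s ^ 2 * F := by nlinarith [sq_nonneg (deriv (K.w i) s)]
  have hx := Real.sq_sqrt hx0.le
  have hxp := Real.sqrt_pos.mpr hx0
  have hr := Real.sq_sqrt hF₀
  have hr0 := Real.sqrt_nonneg F
  set x := √(1 - deriv (K.w i) s ^ 2 * F)
  set r := √F
  set k := 1 / 2 * K.κ i s * K.w i s with hk
  have hk0 : 0 ≤ k := by positivity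
  have hzero : x = k * r → 0 < F := fun hxr => by
    rw [← hr]
    have : r ≠ 0 := by rintro h; rw [h, mul_zero] at hxr; exact hxp.ne' hxr
    positivity
  rcases lt_trichotomy (K.Del i s) 0 with hD | hD | hD
  · have h3 : 0 ≤ F * (K.w i s * -K.Del i s) :=
      mul_nonneg hF₀ (mul_pos hw (by linarith)).le
    refine ⟨by nlinarith [sq_nonneg (x - k * r)], fun h0 => ?_⟩
    exfalso
    have h4 : (x - k * r) ^ 2 = 0 := by nlinarith [sq_nonneg (x - k * r)]
    have h5 : x = k * r := by linarith [pow_eq_zero_iff (two_ne_zero) |>.mp h4]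
    have h6 : 0 < F * (K.w i s * -K.Del i s) := mul_pos (hzero h5) (mul_pos hw (by linarith))
    nlinarith
  · rw [hD]
    refine ⟨by nlinarith [sq_nonneg (x - k * r)], fun h0 => ?_⟩
    have h5 : x = k * r := by
      have : (x - k * r) ^ 2 = 0 := by linarith
      linarith [pow_eq_zero_iff (two_ne_zero) |>.mp this]
    exact ⟨rfl, h5, hzero h5⟩
  · have h3 := h2 hD
    have hwD : 0 < K.w i s * K.Del i s := mul_pos hw hD
    rw [K.Lam_eq, ← hk] at h3
    have hd := Real.sq_sqrt hwD.le
    have hd0 := Real.sqrt_nonneg (K.w i s * K.Del i s)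
    set d := √(K.w i s * K.Del i s)
    -- The bound on Λ reads F(k + d)² < 1 - μ'²F, that is r(k + d) < x. Therefore x - kr exceeds rd
    -- ≥ 0, and the quadratic is positive.
    have h4 : F * (deriv (K.w i) s ^ 2 + (k + d) ^ 2) < 1 := by
      nlinarith [sq_nonneg (deriv (K.w i) s), sq_nonneg (k + d)]
    have h5 : (r * (k + d)) ^ 2 < x ^ 2 := by rw [hx, mul_pow, hr]; linarith
    have h6 : r * (k + d) < x := lt_of_pow_lt_pow_left₀ 2 hxp.le h5
    have h7 : 0 < (x - k * r) ^ 2 - F * (K.w i s * K.Del i s) := by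
      rw [← hd, ← hr]
      have : 0 ≤ r * d := by positivity
      nlinarith
    exact ⟨h7.le, fun h0 => (lt_irrefl 0 (h7.trans_eq h0)).elim⟩

/-- The component of `γ(s) - p` normal to the curve. -/
def normalPart (i : Fin K.m) (p : EuclideanSpace ℝ (Fin n)) (s : ℝ) : EuclideanSpace ℝ (Fin n) :=
  (K.γ i s - p) - (inner ℝ (K.γ i s - p) (deriv (K.γ i) s)) • deriv (K.γ i) s

theorem norm_normalPart_sq (i : Fin K.m) (p : EuclideanSpace ℝ (Fin n)) (s : ℝ) :
    ‖K.normalPart i p s‖ ^ 2 = K.distRatio i p s * K.w i s ^ 2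
      - (inner ℝ (K.γ i s - p) (deriv (K.γ i) s)) ^ 2 := by
  rw [normalPart, norm_sub_sq_real, norm_smul, inner_smul_right, K.norm_sub_sq_eq, K.unit_speed,
    mul_one, Real.norm_eq_abs, sq_abs]
  ring

theorem inner_normalPart (i : Fin K.m) (p : EuclideanSpace ℝ (Fin n)) (s : ℝ) :
    inner ℝ (K.normalPart i p s) (iteratedDeriv 2 (K.γ i) s)
      = inner ℝ (K.γ i s - p) (iteratedDeriv 2 (K.γ i) s) := by
  rw [normalPart, inner_sub_left, inner_smul_left, K.inner_deriv_γ_iteratedDeriv_two]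
  simp

/-- The coefficient of the lower bound for the Hessian in terms of the first derivative. -/
def hessCoeff (i : Fin K.m) (R s : ℝ) : ℝ :=
  K.w i s ^ 2 * |deriv (K.w i) s| / (2 * √(1 - R ^ 2 * deriv (K.w i) s ^ 2))

/-- By `norm_normalPart_sq` the squared length is Fμ²(1 - μ'²F) - Fμ³μ'F' - ¼μ⁴F'². The last term is
dropped, and `hessCoeff` is chosen so that the cross term of the square on the right absorbs the
middle one. Its denominator involves R instead of F, which makes it independent of `p`. -/
theorem norm_normalPart_le (i : Fin K.m) {R s : ℝ} {p : EuclideanSpace ℝ (Fin n)}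
    (hR : K.SubFocal i R) (hF : K.distRatio i p s ≤ R ^ 2) :
    ‖K.normalPart i p s‖ ≤ √(K.distRatio i p s) * (K.w i s
      * √(1 - deriv (K.w i) s ^ 2 * K.distRatio i p s)
      + K.hessCoeff i R s * |K.distRatioDeriv i p s|) := by
  have hw := K.w_pos i s
  have hF0 := K.distRatio_nonneg i p s
  have hμ := (hR.2 s).1
  have h1 := K.norm_normalPart_sq i p s
  rw [K.inner_sub_deriv_γ] at h1
  set F := K.distRatio i p s
  set F' := K.distRatioDeriv i p s
  set μ := K.w i s
  set μ' := deriv (K.w i) s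
  have hx0 : 0 < 1 - R ^ 2 * μ' ^ 2 := by linarith
  have hx1 : 1 - R ^ 2 * μ' ^ 2 ≤ 1 - μ' ^ 2 * F := by nlinarith [sq_nonneg μ']
  have hy := Real.sqrt_pos.mpr hx0
  have hxy := Real.sqrt_le_sqrt hx1
  have hx := Real.sq_sqrt (hx0.le.trans hx1)
  have hr := Real.sq_sqrt hF0
  have hM : K.hessCoeff i R s * (2 * √(1 - R ^ 2 * μ' ^ 2)) = μ ^ 2 * |μ'| := by
    exact div_mul_cancel₀ _ (by positivity)
  have hM0 : 0 ≤ K.hessCoeff i R s := by unfold hessCoeff; positivity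
  set M := K.hessCoeff i R s
  set x := √(1 - μ' ^ 2 * F)
  set y := √(1 - R ^ 2 * μ' ^ 2)
  set r := √F
  have h2 : μ ^ 2 * |μ'| ≤ M * (2 * x) := by rw [← hM]; gcongr
  refine abs_le_of_sq_le_sq' ?_ ?_ |>.2
  · rw [h1, mul_pow, hr]
    have h3 : -(μ' * F') ≤ |μ'| * |F'| := by rw [← abs_mul]; exact neg_le_abs _
    have h4 : F * μ * μ ^ 2 * (-(μ' * F')) ≤ F * μ * μ ^ 2 * (|μ'| * |F'|) := by gcongr
    have h5 : F * μ * |F'| * (μ ^ 2 * |μ'|) ≤ F * μ * |F'| * (M * (2 * x)) := by gcongr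
    have h6 : 0 ≤ F * (M * |F'|) ^ 2 := by positivity
    have h7 : F * (μ * x) ^ 2 = F * μ ^ 2 * (1 - μ' ^ 2 * F) := by rw [mul_pow, hx]; ring
    nlinarith [sq_nonneg (μ ^ 2 * F')]
  · positivity

/-- As γ'' is normal to the curve, Cauchy–Schwarz applies to the normal part of γ - p alone;
inserting its length bound and completing the square gives the quadratic of `focal_quadratic`. -/
theorem distRatioHess_ge (i : Fin K.m) {R s : ℝ} {p : EuclideanSpace ℝ (Fin n)}
    (hR : K.SubFocal i R) (hF : K.distRatio i p s ≤ R ^ 2) :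
    (√(1 - deriv (K.w i) s ^ 2 * K.distRatio i p s)
        - 1 / 2 * K.κ i s * K.w i s * √(K.distRatio i p s)) ^ 2
      - K.distRatio i p s * (K.w i s * K.Del i s)
      - K.κ i s * √(K.distRatio i p s) * K.hessCoeff i R s * |K.distRatioDeriv i p s|
      ≤ K.distRatioHess i p s := by
  have h1 := K.norm_normalPart_le i hR hF
  have h2 : -(‖K.normalPart i p s‖ * K.κ i s)
      ≤ inner ℝ (K.γ i s - p) (iteratedDeriv 2 (K.γ i) s) := by
    rw [← K.inner_normalPart]
    exact neg_le_of_abs_le (abs_real_inner_le_norm _ _)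
  have h3 := mul_le_mul_of_nonneg_right h1 (K.κ_nonneg i s)
  have hF0 := K.distRatio_nonneg i p s
  have hx0 : 0 ≤ 1 - deriv (K.w i) s ^ 2 * K.distRatio i p s := by
    nlinarith [sq_nonneg (deriv (K.w i) s), (hR.2 s).1]
  have hx := Real.sq_sqrt hx0
  have hr := Real.sq_sqrt hF0
  rw [distRatioHess, Del]
  have h4 : (√(1 - deriv (K.w i) s ^ 2 * K.distRatio i p s)
        - 1 / 2 * K.κ i s * K.w i s * √(K.distRatio i p s)) ^ 2
      = 1 - deriv (K.w i) s ^ 2 * K.distRatio i p s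
        - K.κ i s * K.w i s * √(K.distRatio i p s)
          * √(1 - deriv (K.w i) s ^ 2 * K.distRatio i p s)
        + 1 / 4 * K.κ i s ^ 2 * K.w i s ^ 2 * K.distRatio i p s := by
    rw [sub_sq, hx, mul_pow, hr]; ring
  rw [h4]
  linarith

/-- This is F'' ≥ -C|F'|, with one C for all `p`: the quadratic part of the Hessian bound is
nonnegative, and the remaining terms are |F'| times coefficients dominated by a continuous function
of s, using √F ≤ R. -/
theorem exists_neg_mul_abs_le (i : Fin K.m) {R : ℝ} (hR : K.SubFocal i R) (a b : ℝ) :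
    ∃ C : ℝ, ∀ p, ∀ s ∈ Set.Icc a b, K.distRatio i p s ≤ R ^ 2 →
      -(C * |K.distRatioDeriv i p s|) ≤ (2 * K.distRatioHess i p s
        - 4 * K.w i s * deriv (K.w i) s * K.distRatioDeriv i p s) / K.w i s ^ 2 := by
  set c : ℝ → ℝ := fun s => (2 * (K.κ i s * R * K.hessCoeff i R s)
    + 4 * K.w i s * |deriv (K.w i) s|) / K.w i s ^ 2 with hc
  have hcont : Continuous c := by
    have h1 : Continuous (K.hessCoeff i R) := by
      unfold hessCoeff
      refine Continuous.div₀ ?_ ?_ fun s => ?_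
      · exact ((K.continuous_w i).pow 2).mul (K.continuous_deriv_w i).abs
      · exact continuous_const.mul (continuous_const.sub
          (continuous_const.mul ((K.continuous_deriv_w i).pow 2))).sqrt
      · have := Real.sqrt_pos.mpr (sub_pos.mpr (hR.2 s).1)
        positivity
    refine Continuous.div₀ ?_ ((K.continuous_w i).pow 2) fun s => (pow_pos (K.w_pos i s) 2).ne'
    exact (continuous_const.mul (((K.continuous_κ i).mul continuous_const).mul h1)).add
      ((continuous_const.mul (K.continuous_w i)).mul (K.continuous_deriv_w i).abs)
  obtain ⟨C, hC⟩ := isCompact_Icc.bddAbove_image (hcont.continuousOn (s := Set.Icc a b))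
  refine ⟨C, fun p s hs hF => ?_⟩
  have h1 : c s ≤ C := hC ⟨s, hs, rfl⟩
  have hw := K.w_pos i s
  have hge := K.distRatioHess_ge i hR hF
  have hq := (K.focal_quadratic i (s := s) hR (K.distRatio_nonneg i p s) hF).1
  have hr : √(K.distRatio i p s) ≤ R := (Real.sqrt_le_left hR.1).mpr hF
  have hM0 : 0 ≤ K.hessCoeff i R s := by unfold hessCoeff; positivity
  have hκ := K.κ_nonneg i s
  have h2 : K.κ i s * √(K.distRatio i p s) * K.hessCoeff i R s * |K.distRatioDeriv i p s|
      ≤ K.κ i s * R * K.hessCoeff i R s * |K.distRatioDeriv i p s| := by gcongr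
  have h3 : deriv (K.w i) s * K.distRatioDeriv i p s
      ≤ |deriv (K.w i) s| * |K.distRatioDeriv i p s| := by
    rw [← abs_mul]; exact le_abs_self _
  have h4 := mul_le_mul_of_nonneg_left h3 (mul_pos four_pos hw).le
  refine (neg_le_neg (mul_le_mul_of_nonneg_right h1 (abs_nonneg _))).trans ?_
  rw [hc, le_div_iff₀ (by positivity)]
  have h5 : -((2 * (K.κ i s * R * K.hessCoeff i R s)
      + 4 * K.w i s * |deriv (K.w i) s|) / K.w i s ^ 2 * |K.distRatioDeriv i p s|) * K.w i s ^ 2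
      = -((2 * (K.κ i s * R * K.hessCoeff i R s)
      + 4 * K.w i s * |deriv (K.w i) s|) * |K.distRatioDeriv i p s|) := by
    field_simp
  rw [h5]
  linarith

/-- Below the focal radius the weighted distance is quasiconvex along arcs. -/
theorem distRatio_le_max (i : Fin K.m) {R a b : ℝ} {p : EuclideanSpace ℝ (Fin n)}
    (hR : K.SubFocal i R) (hF : ∀ s ∈ Set.Icc a b, K.distRatio i p s ≤ R ^ 2) :
    ∀ s ∈ Set.Icc a b, K.distRatio i p s ≤ max (K.distRatio i p a) (K.distRatio i p b) := by
  obtain ⟨C, hC⟩ := K.exists_neg_mul_abs_le i hR a b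
  exact le_max_of_neg_mul_abs_deriv_le (fun s _ => K.hasDerivAt_distRatio i p s)
    (fun s _ => K.hasDerivAt_distRatioDeriv i p s) (fun s hs => hC p s hs (hF s hs))

theorem distRatioDeriv_eq_zero (i : Fin K.m) {R a b : ℝ} {p : EuclideanSpace ℝ (Fin n)}
    (hR : K.SubFocal i R) (hF : ∀ s ∈ Set.Icc a b, K.distRatio i p s ≤ R ^ 2)
    (ha : K.distRatioDeriv i p a = 0) (hb : K.distRatioDeriv i p b = 0) :
    ∀ s ∈ Set.Icc a b, K.distRatioDeriv i p s = 0 := by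
  obtain ⟨C, hC⟩ := K.exists_neg_mul_abs_le i hR a b
  exact deriv_eq_zero_of_neg_mul_abs_deriv_le
    (fun s _ => K.hasDerivAt_distRatioDeriv i p s) (fun s hs => hC p s hs (hF s hs)) ha hb

end WeightedLink
end

/-! ### Arcs within a weighted ball and the double critical self distance -/

noncomputable section

namespace WeightedLink

open Filter Topology

variable {n : ℕ} (K : WeightedLink n)

theorem distRatio_periodic (i : Fin K.m) (p : EuclideanSpace ℝ (Fin n)) :
    Function.Periodic (K.distRatio i p) (K.L i) := fun s => by
  rw [distRatio, distRatio, K.periodic i s, K.w_periodic i s]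

theorem distRatio_le_sq_iff (i : Fin K.m) {R s : ℝ} {p : EuclideanSpace ℝ (Fin n)} (hR : 0 ≤ R) :
    K.distRatio i p s ≤ R ^ 2 ↔ p ∈ Metric.closedBall (K.γ i s) (R * K.w i s) := by
  have hw := K.w_pos i s
  rw [mem_closedBall_iff_norm', distRatio, div_le_iff₀ (by positivity), ← mul_pow,
    sq_le_sq₀ (norm_nonneg _) (by positivity)]

theorem continuous_distRatio_comp (i : Fin K.m) {X : Type*} [TopologicalSpace X]
    {P : X → EuclideanSpace ℝ (Fin n)} {a : X → ℝ} (hP : Continuous P) (ha : Continuous a) :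
    Continuous fun x => K.distRatio i (P x) (a x) := by
  unfold distRatio
  exact ((((K.continuous_γ i).comp ha).sub hP).norm.pow 2).div₀
    (((K.continuous_w i).comp ha).pow 2) fun x => (pow_pos (K.w_pos i _) 2).ne'

theorem continuous_Sig (i j : Fin K.m) :
    Continuous fun z : ℝ × ℝ => K.Sig (K.γ i z.1) (K.γ j z.2) := by
  unfold Sig
  refine Continuous.div₀ ?_ ?_ fun z => ?_
  · exact (((K.continuous_γ i).comp continuous_fst).sub
      ((K.continuous_γ j).comp continuous_snd)).norm.pow 2
  · exact (((K.continuous_w i).comp continuous_fst).add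
      ((K.continuous_w j).comp continuous_snd)).pow 2
  · exact (pow_pos (add_pos (K.μ_pos i _) (K.μ_pos j _)) 2).ne'

theorem Sig_le_of_distRatio_le {i j : Fin K.m} {R s t : ℝ} {p : EuclideanSpace ℝ (Fin n)}
    (hR : 0 ≤ R) (hs : K.distRatio i p s ≤ R ^ 2) (ht : K.distRatio j p t ≤ R ^ 2) :
    K.Sig (K.γ i s) (K.γ j t) ≤ R ^ 2 := by
  rw [K.distRatio_le_sq_iff _ hR, mem_closedBall_iff_norm'] at hs
  rw [K.distRatio_le_sq_iff _ hR, mem_closedBall_iff_norm] at ht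
  have h1 := K.w_pos i s
  have h2 := K.w_pos j t
  have h3 : ‖K.γ i s - K.γ j t‖ ≤ R * (K.w i s + K.w j t) := by
    have := norm_add_le (K.γ i s - p) (p - K.γ j t)
    rw [sub_add_sub_cancel] at this
    linarith
  change ‖K.γ i s - K.γ j t‖ ^ 2 / (K.w i s + K.w j t) ^ 2 ≤ R ^ 2
  rw [div_le_iff₀ (by positivity), ← mul_pow]
  exact pow_le_pow_left₀ (norm_nonneg _) h3 2

/-- Below the double critical self distance `Σ` has no local minima off the diagonal. -/
theorem γ_eq_of_isLocalMin_Sig {i j : Fin K.m} {R s t : ℝ} (hR₀ : 0 ≤ R)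
    (hR : ENNReal.ofReal R < K.halfDCSD) (hS : K.Sig (K.γ i s) (K.γ j t) ≤ R ^ 2)
    (hmin : IsLocalMin (fun z : ℝ × ℝ => K.Sig (K.γ i z.1) (K.γ j z.2)) (s, t)) :
    K.γ i s = K.γ j t := by
  by_contra hne
  have h1 : IsLocalMin (fun a => K.Sig (K.γ i a) (K.γ j t)) s :=
    (show Tendsto (fun a : ℝ => (a, t)) (𝓝 s) (𝓝 (s, t)) from
      (by fun_prop : Continuous fun a : ℝ => (a, t)).tendsto s).eventually hmin
  have h2 : IsLocalMin (fun b => K.Sig (K.γ i s) (K.γ j b)) t :=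
    (show Tendsto (fun b : ℝ => (s, b)) (𝓝 t) (𝓝 (s, t)) from
      (by fun_prop : Continuous fun b : ℝ => (s, b)).tendsto t).eventually hmin
  have hcrit : K.IsDoubleCriticalPair (K.γ i s) (K.γ j t) :=
    ⟨hne, i, s, j, t, rfl, rfl, h1.deriv_eq_zero, h2.deriv_eq_zero⟩
  have h3 : K.halfDCSD ≤ ENNReal.ofReal (‖K.γ i s - K.γ j t‖ / (K.μ (K.γ i s) + K.μ (K.γ j t))) :=
    iInf_le_of_le _ (iInf_le_of_le _ (iInf_le _ hcrit))
  have h4 : ‖K.γ i s - K.γ j t‖ / (K.μ (K.γ i s) + K.μ (K.γ j t)) ≤ R := by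
    refine abs_le_of_sq_le_sq' ?_ hR₀ |>.2
    rw [div_pow]
    exact hS
  exact absurd (hR.trans_le h3) (not_lt.mpr (ENNReal.ofReal_le_ofReal h4))

/-- Below the double critical self distance weighted balls centred at points of different
components do not meet. -/
theorem eq_of_Sig_le {i j : Fin K.m} {R s t : ℝ} (hR₀ : 0 ≤ R)
    (hR : ENNReal.ofReal R < K.halfDCSD) (hS : K.Sig (K.γ i s) (K.γ j t) ≤ R ^ 2) : i = j := by
  -- By periodicity Σ attains a global minimum. It is at most R², so below ½DCSD it can only be
  -- attained at coinciding points, and disjoint components have none.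
  have hcomp : IsCompact (Set.Icc 0 (K.L i) ×ˢ Set.Icc 0 (K.L j)) :=
    isCompact_Icc.prod isCompact_Icc
  obtain ⟨z, -, hz⟩ := hcomp.exists_isMinOn
    ⟨(0, 0), ⟨le_rfl, (K.L_pos i).le⟩, ⟨le_rfl, (K.L_pos j).le⟩⟩
    (K.continuous_Sig i j).continuousOn
  have hall : ∀ z' : ℝ × ℝ, K.Sig (K.γ i z.1) (K.γ j z.2) ≤ K.Sig (K.γ i z'.1) (K.γ j z'.2) := by
    intro z'
    obtain ⟨a, ha, hae⟩ := (K.periodic i).exists_mem_Ico₀ (K.L_pos i) z'.1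
    obtain ⟨b, hb, hbe⟩ := (K.periodic j).exists_mem_Ico₀ (K.L_pos j) z'.2
    rw [hae, hbe]
    have hab : (a, b) ∈ Set.Icc 0 (K.L i) ×ˢ Set.Icc 0 (K.L j) :=
      ⟨⟨ha.1, ha.2.le⟩, ⟨hb.1, hb.2.le⟩⟩
    exact isMinOn_iff.mp hz (a, b) hab
  exact (K.exists_eq_add_of_γ_eq (K.γ_eq_of_isLocalMin_Sig (s := z.1) (t := z.2) hR₀ hR
    ((hall (s, t)).trans hS) (Eventually.of_forall hall))).1

/-- The arc with parameters from `a` to `b` lies within weighted distance `R` of `p`. -/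
def Joined (i : Fin K.m) (R : ℝ) (p : EuclideanSpace ℝ (Fin n)) (a b : ℝ) : Prop :=
  ∀ θ ∈ Set.Icc (0 : ℝ) 1, K.distRatio i p (a + θ * (b - a)) ≤ R ^ 2

variable {K}

theorem Joined.le {i : Fin K.m} {R a b : ℝ} {p : EuclideanSpace ℝ (Fin n)}
    (h : K.Joined i R p a b) : ∀ s ∈ Set.Icc a b, K.distRatio i p s ≤ R ^ 2 := by
  intro s hs
  rcases (hs.1.trans hs.2).eq_or_lt with rfl | hab
  · obtain rfl := le_antisymm hs.1 hs.2
    simpa using h 0 (by simp)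
  · have := h ((s - a) / (b - a)) ⟨div_nonneg (by linarith [hs.1]) (by linarith),
      (div_le_one (by linarith)).mpr (by linarith [hs.2])⟩
    rwa [div_mul_cancel₀ _ (by linarith), add_sub_cancel] at this

theorem joined_of_le {i : Fin K.m} {R a b : ℝ} {p : EuclideanSpace ℝ (Fin n)} (hab : a ≤ b)
    (h : ∀ s ∈ Set.Icc a b, K.distRatio i p s ≤ R ^ 2) : K.Joined i R p a b := fun θ hθ =>
  h _ ⟨by nlinarith [hθ.1], by nlinarith [hθ.2]⟩

variable (K)

theorem isClosed_setOf_joined (i : Fin K.m) (R : ℝ) {X : Type*} [TopologicalSpace X]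
    {P : X → EuclideanSpace ℝ (Fin n)} {a b : X → ℝ} (hP : Continuous P) (ha : Continuous a)
    (hb : Continuous b) : IsClosed {x | K.Joined i R (P x) (a x) (b x)} := by
  simp only [Joined, Set.ofPred_forall]
  exact isClosed_iInter fun θ => isClosed_iInter fun _ => isClosed_le
    (K.continuous_distRatio_comp i hP (ha.add (continuous_const.mul (hb.sub ha))))
    continuous_const

/-- The arc property is open among data whose end points satisfy the bound: by compactness nearby
arcs stay below the larger level R', and quasiconvexity at level R' pushes them back below R.
Parametrizing arcs by [0, 1] lets their end points vary. -/
theorem eventually_joined (i : Fin K.m) {R R' : ℝ} (hR : 0 ≤ R) (hRR' : R < R')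
    (hR' : K.SubFocal i R') {X : Type*} [TopologicalSpace X]
    {P : X → EuclideanSpace ℝ (Fin n)} {a b : X → ℝ} (hP : Continuous P) (ha : Continuous a)
    (hb : Continuous b) {x : X} (hx : K.Joined i R (P x) (a x) (b x)) :
    ∀ᶠ y in 𝓝 x, a y ≤ b y → K.distRatio i (P y) (a y) ≤ R ^ 2 →
      K.distRatio i (P y) (b y) ≤ R ^ 2 → K.Joined i R (P y) (a y) (b y) := by
  have hlt : R ^ 2 < R' ^ 2 := pow_lt_pow_left₀ hRR' hR two_ne_zero
  have hcont : Continuous fun z : X × ℝ =>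
      K.distRatio i (P z.1) (a z.1 + z.2 * (b z.1 - a z.1)) :=
    K.continuous_distRatio_comp i (hP.comp continuous_fst)
      ((ha.comp continuous_fst).add (continuous_snd.mul
        ((hb.comp continuous_fst).sub (ha.comp continuous_fst))))
  have h1 : ∀ᶠ y in 𝓝 x, ∀ θ ∈ Set.Icc (0 : ℝ) 1,
      K.distRatio i (P y) (a y + θ * (b y - a y)) < R' ^ 2 := by
    refine isCompact_Icc.eventually_forall_of_forall_eventually fun θ hθ => ?_
    exact (hcont.tendsto (x, θ)).eventually (gt_mem_nhds ((hx θ hθ).trans_lt hlt))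
  filter_upwards [h1] with y hy hab hay hby
  have hJ : K.Joined i R' (P y) (a y) (b y) := fun θ hθ => (hy θ hθ).le
  exact joined_of_le hab fun s hs => (K.distRatio_le_max i hR' hJ.le s hs).trans (max_le hay hby)

/-- The point of the segment from `γ(s)` to `γ(t)` at equal weighted distances from its ends. -/
def segPoint (i : Fin K.m) (s t : ℝ) : EuclideanSpace ℝ (Fin n) :=
  K.γ i s + (K.w i s / (K.w i s + K.w i t)) • (K.γ i t - K.γ i s)

theorem continuous_segPoint (i : Fin K.m) :
    Continuous fun z : ℝ × ℝ => K.segPoint i z.1 z.2 := by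
  unfold segPoint
  have h1 := (K.continuous_w i).comp (continuous_fst (X := ℝ) (Y := ℝ))
  have h2 := (K.continuous_w i).comp (continuous_snd (X := ℝ) (Y := ℝ))
  have h3 := (K.continuous_γ i).comp (continuous_fst (X := ℝ) (Y := ℝ))
  have h4 := (K.continuous_γ i).comp (continuous_snd (X := ℝ) (Y := ℝ))
  exact h3.add ((h1.div₀ (h1.add h2)
    fun z => (add_pos (K.w_pos i _) (K.w_pos i _)).ne').smul (h4.sub h3))

theorem distRatio_segPoint_left (i : Fin K.m) (s t : ℝ) :
    K.distRatio i (K.segPoint i s t) s = K.Sig (K.γ i s) (K.γ i t) := by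
  have h1 := K.w_pos i s
  have h2 := K.w_pos i t
  have h3 : K.γ i s - K.segPoint i s t
      = (K.w i s / (K.w i s + K.w i t)) • (K.γ i s - K.γ i t) := by
    rw [segPoint]; module
  rw [distRatio, h3, norm_smul, Real.norm_of_nonneg (by positivity), Sig, mul_pow]
  change _ = _ / (K.w i s + K.w i t) ^ 2
  field_simp

theorem distRatio_segPoint_right (i : Fin K.m) (s t : ℝ) :
    K.distRatio i (K.segPoint i s t) t = K.Sig (K.γ i s) (K.γ i t) := by
  have h1 := K.w_pos i s
  have h2 := K.w_pos i t
  have h3 : K.γ i t - K.segPoint i s t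
      = -((K.w i t / (K.w i s + K.w i t)) • (K.γ i s - K.γ i t)) := by
    have : K.w i t / (K.w i s + K.w i t) = 1 - K.w i s / (K.w i s + K.w i t) := by
      field_simp; ring
    rw [segPoint, this]; module
  rw [distRatio, h3, norm_neg, norm_smul, Real.norm_of_nonneg (by positivity), Sig, mul_pow]
  change _ = _ / (K.w i s + K.w i t) ^ 2
  field_simp

theorem segPoint_of_γ_eq (i : Fin K.m) {s t : ℝ} (h : K.γ i s = K.γ i t) :
    K.segPoint i s t = K.γ i s := by
  rw [segPoint, h]; simp

/-- Below the upper radius, two points of a component whose weighted balls meet bound an arc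
that stays close to the point `segPoint`. -/
theorem joined_segPoint (i : Fin K.m) {R R' : ℝ} (hR₀ : 0 ≤ R) (hRR' : R < R')
    (hR' : K.SubFocal i R') (hR : ENNReal.ofReal R < K.halfDCSD) {s t : ℝ} (hst : s ≤ t)
    (hts : t ≤ s + K.L i) (hS : K.Sig (K.γ i s) (K.γ i t) ≤ R ^ 2) :
    K.Joined i R (K.segPoint i s t) s t ∨ K.Joined i R (K.segPoint i s t) t (s + K.L i) := by
  set Q : ℝ × ℝ → Prop := fun z => K.Joined i R (K.segPoint i z.1 z.2) z.1 z.2 ∨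
    K.Joined i R (K.segPoint i z.1 z.2) z.2 (z.1 + K.L i) with hQ
  set D : Set (ℝ × ℝ) := {z | z.1 ≤ z.2 ∧ z.2 ≤ z.1 + K.L i ∧
    K.Sig (K.γ i z.1) (K.γ i z.2) ≤ R ^ 2} with hD
  set S : Set (ℝ × ℝ) := {z | z ∈ D ∧ ¬ Q z} with hSdef
  have hDclosed : IsClosed D :=
    (isClosed_le continuous_fst continuous_snd).inter
      ((isClosed_le continuous_snd (continuous_fst.add continuous_const)).inter
        (isClosed_le (K.continuous_Sig i i) continuous_const))
  have hQclosed : IsClosed {z | Q z} :=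
    (K.isClosed_setOf_joined i R (K.continuous_segPoint i) continuous_fst continuous_snd).union
      (K.isClosed_setOf_joined i R (K.continuous_segPoint i) continuous_snd
        (continuous_fst.add continuous_const))
  -- Both alternatives in `Q` are open relative to `D`, so the violating pairs form a closed set.
  have hSclosed : IsClosed S := by
    rw [← isOpen_compl_iff, isOpen_iff_mem_nhds]
    intro z hz
    by_cases hzD : z ∈ D
    · have hzQ : Q z := by
        by_contra h
        exact hz ⟨hzD, h⟩
      rcases hzQ with h | h
      · filter_upwards [K.eventually_joined i hR₀ hRR' hR' (K.continuous_segPoint i)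
          continuous_fst continuous_snd h] with y hy hyS
        refine hyS.2 (Or.inl (hy hyS.1.1 ?_ ?_))
        · rw [K.distRatio_segPoint_left]; exact hyS.1.2.2
        · rw [K.distRatio_segPoint_right]; exact hyS.1.2.2
      · filter_upwards [K.eventually_joined i hR₀ hRR' hR' (K.continuous_segPoint i)
          continuous_snd (continuous_fst.add continuous_const) h] with y hy hyS
        refine hyS.2 (Or.inr (hy hyS.1.2.1 ?_ ?_))
        · rw [K.distRatio_segPoint_right]; exact hyS.1.2.2
        · change K.distRatio i _ (y.1 + K.L i) ≤ _
          rw [K.distRatio_periodic i, K.distRatio_segPoint_left]; exact hyS.1.2.2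
    · filter_upwards [hDclosed.isOpen_compl.mem_nhds hzD] with y hy hyS
      exact hy hyS.1
  have hshift : ∀ z ∈ S, ∀ k : ℤ, (z.1 + k • K.L i, z.2 + k • K.L i) ∈ S := by
    intro z hz k
    have hg := (K.periodic i).zsmul k
    have hw := (K.w_periodic i).zsmul k
    have hseg : K.segPoint i (z.1 + k • K.L i) (z.2 + k • K.L i) = K.segPoint i z.1 z.2 := by
      rw [segPoint, segPoint, hg z.1, hg z.2, hw z.1, hw z.2]
    have hJ : ∀ p a b, K.Joined i R p (a + k • K.L i) (b + k • K.L i) → K.Joined i R p a b := by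
      intro p a b h θ hθ
      have := h θ hθ
      rwa [show a + k • K.L i + θ * (b + k • K.L i - (a + k • K.L i))
        = a + θ * (b - a) + k • K.L i by ring, (K.distRatio_periodic i p).zsmul k] at this
    refine ⟨⟨by simpa using hz.1.1, ?_, ?_⟩, ?_⟩
    · have := hz.1.2.1
      simp only
      linarith
    · simp only
      rw [hg z.1, hg z.2]
      exact hz.1.2.2
    · intro hq
      simp only [hQ, hseg] at hq
      refine hz.2 (hq.imp (hJ _ _ _) fun h => hJ _ _ _ ?_)
      rwa [add_right_comm] at h
  by_contra hcon
  have hmem : (s, t) ∈ S := ⟨⟨hst, hts, hS⟩, hcon⟩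
  -- Translation by periods reduces the minimization over `S` to a compact set.
  have hnorm : ∀ z ∈ S, ∃ z' ∈ S ∩ Set.Icc 0 (K.L i) ×ˢ Set.Icc 0 (2 * K.L i),
      K.Sig (K.γ i z'.1) (K.γ i z'.2) = K.Sig (K.γ i z.1) (K.γ i z.2) := by
    intro z hz
    obtain ⟨k, hk, -⟩ := existsUnique_add_zsmul_mem_Ico (K.L_pos i) z.1 0
    have hz' := hshift z hz k
    refine ⟨_, ⟨hz', ⟨hk.1, by linarith [hk.2]⟩, ?_⟩, ?_⟩
    · have h1 := hz'.1.1
      have h2 := hz'.1.2.1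
      simp only at h1 h2
      exact ⟨hk.1.trans h1, by simp only; linarith [hk.2]⟩
    · simp only
      rw [(K.periodic i).zsmul k z.1, (K.periodic i).zsmul k z.2]
  obtain ⟨z', hz', -⟩ := hnorm _ hmem
  obtain ⟨z₀, hz₀, hz₀min⟩ := ((isCompact_Icc.prod isCompact_Icc).inter_left
    hSclosed).exists_isMinOn ⟨z', hz'⟩ (K.continuous_Sig i i).continuousOn
  have hmin : ∀ z ∈ S, K.Sig (K.γ i z₀.1) (K.γ i z₀.2) ≤ K.Sig (K.γ i z.1) (K.γ i z.2) := by
    intro z hz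
    obtain ⟨y, hy, hye⟩ := hnorm z hz
    rw [← hye]
    exact hz₀min hy
  have hz₀S := hz₀.1
  have hball : ∀ u, K.γ i u = K.γ i z₀.1 →
      K.distRatio i (K.γ i z₀.1) u ≤ R ^ 2 := fun u hu => by
    simpa [distRatio, hu] using sq_nonneg R
  -- On the two boundary lines of `D` the points coincide and one of the arcs degenerates to a
  -- single parameter, so `Q` holds there.
  have h1 : z₀.1 < z₀.2 := by
    refine lt_of_le_of_ne hz₀S.1.1 fun he => hz₀S.2 (Or.inl ?_)
    rw [K.segPoint_of_γ_eq i (by rw [he]), ← he]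
    intro θ _
    exact hball _ (by simp)
  have h2 : z₀.2 < z₀.1 + K.L i := by
    refine lt_of_le_of_ne hz₀S.1.2.1 fun he => hz₀S.2 (Or.inr ?_)
    rw [K.segPoint_of_γ_eq i (by rw [he, K.periodic i]), he]
    intro θ _
    exact hball _ (by simpa using K.periodic i _)
  -- A nearby pair either has Σ > R², or still violates `Q` because `Q` is closed; in both cases its
  -- Σ is no smaller.
  have hloc : IsLocalMin (fun z : ℝ × ℝ => K.Sig (K.γ i z.1) (K.γ i z.2)) (z₀.1, z₀.2) := by
    filter_upwards [(isOpen_lt continuous_fst continuous_snd).mem_nhds h1,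
      (isOpen_lt continuous_snd (continuous_fst.add continuous_const)).mem_nhds h2,
      hQclosed.isOpen_compl.mem_nhds hz₀S.2] with z hz1 hz2 hz3
    rcases le_or_gt (K.Sig (K.γ i z.1) (K.γ i z.2)) (R ^ 2) with hle | hgt
    · exact hmin z ⟨⟨le_of_lt hz1, le_of_lt hz2, hle⟩, hz3⟩
    · exact hz₀S.1.2.2.trans hgt.le
  obtain ⟨-, k, hk⟩ := K.exists_eq_add_of_γ_eq (K.γ_eq_of_isLocalMin_Sig hR₀ hR hz₀S.1.2.2 hloc)
  have hL := K.L_pos i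
  have hk1 : (k : ℝ) < 0 := by nlinarith
  have hk2 : (-1 : ℝ) < k := by nlinarith
  have hk1' : k < 0 := by exact_mod_cast hk1
  have hk2' : -1 < k := by exact_mod_cast hk2
  omega

/-- The arc property passes from one common point of two weighted balls to any other. -/
theorem Joined.of_mem (i : Fin K.m) {R R' : ℝ} (hR₀ : 0 ≤ R) (hRR' : R < R')
    (hR' : K.SubFocal i R') {p p' : EuclideanSpace ℝ (Fin n)} {a b : ℝ} (hab : a ≤ b)
    (h : K.Joined i R p a b) (ha : K.distRatio i p' a ≤ R ^ 2)
    (hb : K.distRatio i p' b ≤ R ^ 2) : K.Joined i R p' a b := by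
  set P : ℝ → EuclideanSpace ℝ (Fin n) := fun τ => p + τ • (p' - p) with hPdef
  have hP : Continuous P := by fun_prop
  have hend : ∀ u, K.distRatio i p u ≤ R ^ 2 → K.distRatio i p' u ≤ R ^ 2 →
      ∀ τ ∈ Set.Icc (0 : ℝ) 1, K.distRatio i (P τ) u ≤ R ^ 2 := by
    intro u h1 h2 τ hτ
    rw [K.distRatio_le_sq_iff i hR₀] at h1 h2 ⊢
    exact (convex_closedBall _ _).add_smul_sub_mem h1 h2 hτ
  have hsub : Set.Icc (0 : ℝ) 1 ⊆ {τ | K.Joined i R (P τ) a b} := by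
    -- As `p` moves along the segment to `p'`, convexity of the balls keeps both end conditions, and
    -- the arc property is closed and open to the right.
    refine IsClosed.Icc_subset_of_forall_mem_nhdsWithin
      ((K.isClosed_setOf_joined i R hP continuous_const continuous_const).inter isClosed_Icc)
      (by simpa [hPdef] using h) ?_
    rintro τ ⟨hτ, hτ1⟩
    filter_upwards [nhdsWithin_le_nhds (K.eventually_joined i hR₀ hRR' hR' hP
      (continuous_const (y := a)) (continuous_const (y := b)) hτ), self_mem_nhdsWithin,
      nhdsWithin_le_nhds (Iio_mem_nhds hτ1.2)] with σ hσ hσ1 hσ2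
    have hσI : σ ∈ Set.Icc (0 : ℝ) 1 := ⟨hτ1.1.trans (le_of_lt hσ1), le_of_lt hσ2⟩
    exact hσ hab (hend a (h.le a ⟨le_rfl, hab⟩) ha σ hσI) (hend b (h.le b ⟨hab, le_rfl⟩) hb σ hσI)
  have := hsub (show (1 : ℝ) ∈ Set.Icc (0 : ℝ) 1 by simp)
  simpa [hPdef] using this

theorem joined_of_distRatio_le (i : Fin K.m) {R R' : ℝ} (hR₀ : 0 ≤ R) (hRR' : R < R')
    (hR' : K.SubFocal i R') (hR : ENNReal.ofReal R < K.halfDCSD) {s t : ℝ} (hst : s ≤ t)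
    (hts : t ≤ s + K.L i) {p : EuclideanSpace ℝ (Fin n)} (hs : K.distRatio i p s ≤ R ^ 2)
    (ht : K.distRatio i p t ≤ R ^ 2) :
    K.Joined i R p s t ∨ K.Joined i R p t (s + K.L i) := by
  refine (K.joined_segPoint i hR₀ hRR' hR' hR hst hts
    (K.Sig_le_of_distRatio_le hR₀ hs ht)).imp (fun h => ?_) fun h => ?_
  · exact h.of_mem K i hR₀ hRR' hR' hst hs ht
  · exact h.of_mem K i hR₀ hRR' hR' hts ht (by rwa [K.distRatio_periodic i p])

end WeightedLink
end

/-! ### Degenerate critical points -/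

/-- A function with vanishing derivative on a closed interval is constant there. -/
theorem eq_left_of_hasDerivAt_eq_zero {E : Type*} [NormedAddCommGroup E] [NormedSpace ℝ E]
    {f f' : ℝ → E} {a b : ℝ} (hf : ∀ s, HasDerivAt f (f' s) s)
    (h : ∀ s ∈ Set.Icc a b, f' s = 0) : ∀ s ∈ Set.Icc a b, f s = f a :=
  constant_of_has_deriv_right_zero (fun s _ => (hf s).continuousAt.continuousWithinAt)
    fun s hs => by
      have := (hf s).hasDerivWithinAt (s := Set.Ici s)
      rwa [h s ⟨hs.1, hs.2.le⟩] at this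

/-- The derivative of a function that is constant on a nondegenerate interval vanishes there. -/
theorem hasDerivAt_eq_zero_of_eq_const {E : Type*} [NormedAddCommGroup E] [NormedSpace ℝ E]
    {f : ℝ → E} {f' c : E} {J : Set ℝ} (hJ : J.OrdConnected) (hJi : (interior J).Nonempty) {s : ℝ}
    (hs : s ∈ J) (hf : HasDerivAt f f' s) (h : ∀ t ∈ J, f t = c) : f' = 0 :=
  (uniqueDiffOn_convex hJ.convex hJi s hs).eq_deriv _ hf.hasDerivWithinAt
    ((hasDerivWithinAt_const s J c).congr h (h s hs))

noncomputable section

namespace WeightedLink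

variable {n : ℕ} (K : WeightedLink n)

theorem expMu_γ (i : Fin K.m) {s r : ℝ} {v : EuclideanSpace ℝ (Fin n)} (hr : 0 ≤ r)
    (hv : ‖v‖ = 1) :
    K.expMu (K.γ i s) (r • v) = K.γ i s - (K.w i s * r ^ 2 * deriv (K.w i) s) • deriv (K.γ i) s
      + (K.w i s * √(1 - deriv (K.w i) s ^ 2 * r ^ 2) * r) • v := by
  have h1 : ‖r • v‖ = r := by rw [norm_smul, hv, mul_one, Real.norm_of_nonneg hr]
  rw [expMu, h1, K.grad_γ, norm_smul, K.unit_speed, mul_one, Real.norm_eq_abs, sq_abs, smul_smul,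
    smul_smul]
  rfl

theorem expMu_eq_iff_normalPart (i : Fin K.m) {s r : ℝ} {v p : EuclideanSpace ℝ (Fin n)}
    (hr : 0 ≤ r) (hv : ‖v‖ = 1) :
    K.expMu (K.γ i s) (r • v) = p ↔
      K.γ i s - p = (K.w i s * r ^ 2 * deriv (K.w i) s) • deriv (K.γ i) s
        - (K.w i s * √(1 - deriv (K.w i) s ^ 2 * r ^ 2) * r) • v := by
  rw [K.expMu_γ i hr hv]
  constructor
  · rintro rfl; abel
  · intro h
    rw [sub_eq_iff_eq_add] at h
    rw [h]; abel

/-- A point `exp^μ(γ(s), r v)` has `γ(s)` as a critical point of the weighted distance, with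
value `r`. -/
theorem distRatio_of_expMu_eq (i : Fin K.m) {s r : ℝ} {v p : EuclideanSpace ℝ (Fin n)}
    (hr : K.SubFocal i r) (hv : ‖v‖ = 1) (hvn : inner ℝ (deriv (K.γ i) s) v = 0)
    (hp : K.expMu (K.γ i s) (r • v) = p) :
    K.distRatio i p s = r ^ 2 ∧ K.distRatioDeriv i p s = 0 := by
  have hw := K.w_pos i s
  rw [K.expMu_eq_iff_normalPart i hr.1 hv] at hp
  have hx := Real.sq_sqrt (show 0 ≤ 1 - deriv (K.w i) s ^ 2 * r ^ 2 by linarith [(hr.2 s).1])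
  have h1 : K.distRatio i p s = r ^ 2 := by
    rw [distRatio, div_eq_iff (by positivity), hp, norm_sub_sq_real, inner_smul_left,
      inner_smul_right, hvn, norm_smul, norm_smul, hv, K.unit_speed, mul_one, mul_one,
      Real.norm_eq_abs, Real.norm_eq_abs, sq_abs, sq_abs, mul_pow _ r, mul_pow _ √_, hx]
    ring
  refine ⟨h1, ?_⟩
  rw [distRatioDeriv, h1, hp, inner_sub_left, inner_smul_left, inner_smul_left,
    K.inner_deriv_γ_self, real_inner_comm, hvn, div_eq_zero_iff]
  left
  simp only [conj_trivial]
  ring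

theorem norm_N (i : Fin K.m) {s : ℝ} (h : 0 < K.κ i s) : ‖K.N i s‖ = 1 := by
  rw [N, norm_smul, norm_inv, Real.norm_of_nonneg h.le]
  exact inv_mul_cancel₀ h.ne'

theorem inner_deriv_γ_N (i : Fin K.m) (s : ℝ) : inner ℝ (deriv (K.γ i) s) (K.N i s) = 0 := by
  rw [N, inner_smul_right, K.inner_deriv_γ_iteratedDeriv_two, mul_zero]

/-- At a degenerate critical point of value `r` below the focal radius, `p` lies in the
osculating plane and `μ` and `κ` are related. -/
theorem degenerate_critical (i : Fin K.m) {s r : ℝ} {p : EuclideanSpace ℝ (Fin n)}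
    (hr : K.SubFocal i r) (hF : K.distRatio i p s = r ^ 2) (hF' : K.distRatioDeriv i p s = 0)
    (hH : K.distRatioHess i p s = 0) :
    0 < r ∧ 0 < K.κ i s ∧ K.Del i s = 0 ∧
      √(1 - deriv (K.w i) s ^ 2 * r ^ 2) = 1 / 2 * K.κ i s * K.w i s * r ∧
      K.γ i s - p = (K.w i s * r ^ 2 * deriv (K.w i) s) • deriv (K.γ i) s
        - (1 / 2 * K.w i s ^ 2 * r ^ 2) • iteratedDeriv 2 (K.γ i) s := by
  have hw := K.w_pos i s
  have hge := K.distRatioHess_ge i hr hF.le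
  have hq := K.focal_quadratic i (s := s) hr (sq_nonneg r) le_rfl
  rw [hF, Real.sqrt_sq hr.1, hF', hH, abs_zero, mul_zero, sub_zero] at hge
  rw [Real.sqrt_sq hr.1] at hq
  -- The quadratic is squeezed between 0 and the vanishing Hessian.
  obtain ⟨hD, hx, hr2⟩ := hq.2 (le_antisymm hge hq.1)
  have hrpos : 0 < r := lt_of_le_of_ne hr.1 (by rintro rfl; simp at hr2)
  have hx0 : 0 < 1 - deriv (K.w i) s ^ 2 * r ^ 2 := by linarith [(hr.2 s).1]
  have hκ : 0 < K.κ i s := by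
    refine lt_of_le_of_ne (K.κ_nonneg i s) fun h0 => ?_
    rw [← h0] at hx
    have := Real.sqrt_pos.mpr hx0
    rw [hx] at this
    simp at this
  refine ⟨hrpos, hκ, hD, hx, ?_⟩
  have hxs := Real.sq_sqrt hx0.le
  rw [hx] at hxs
  have hin := K.inner_sub_deriv_γ i p s
  rw [hF, hF', mul_zero, add_zero] at hin
  have hn := K.norm_normalPart_sq i p s
  rw [hF, hin] at hn
  have hi := K.inner_normalPart i p s
  have hH' := hH
  rw [distRatioHess, hF] at hH'
  rw [Del] at hD
  have hD' : K.w i s * iteratedDeriv 2 (K.w i) s = -(1 / 4 * K.κ i s ^ 2 * K.w i s ^ 2) := by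
    have := congrArg (K.w i s * ·) hD
    simp only [mul_add, mul_zero] at this
    linarith
  have hi' : inner ℝ (K.normalPart i p s) (iteratedDeriv 2 (K.γ i) s)
      = -(1 / 2 * K.κ i s ^ 2 * K.w i s ^ 2 * r ^ 2) := by
    rw [hi]
    rw [hD'] at hH'
    linarith
  -- The equality case of Cauchy–Schwarz, obtained by expanding the square: the normal part of γ - p
  -- is a negative multiple of γ''.
  have hzero : ‖K.normalPart i p s
      + (1 / 2 * K.w i s ^ 2 * r ^ 2) • iteratedDeriv 2 (K.γ i) s‖ ^ 2 = 0 := by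
    rw [norm_add_sq_real, inner_smul_right, hi', hn, norm_smul, Real.norm_of_nonneg (by positivity)]
    change _ + (_ * K.κ i s) ^ 2 = 0
    have : r ^ 2 * K.w i s ^ 2 - (r ^ 2 * K.w i s * deriv (K.w i) s) ^ 2
      = r ^ 2 * K.w i s ^ 2 * (1 - deriv (K.w i) s ^ 2 * r ^ 2) := by ring
    rw [this, ← hxs]
    ring
  rw [sq_eq_zero_iff, norm_eq_zero, normalPart, hin] at hzero
  rw [eq_sub_iff_add_eq, ← sub_eq_zero, ← hzero]
  module

theorem expMu_N_of_degenerate (i : Fin K.m) {s r : ℝ} {p : EuclideanSpace ℝ (Fin n)}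
    (hr : K.SubFocal i r) (hF : K.distRatio i p s = r ^ 2) (hF' : K.distRatioDeriv i p s = 0)
    (hH : K.distRatioHess i p s = 0) : K.expMu (K.γ i s) (r • K.N i s) = p := by
  obtain ⟨-, hκ, -, hx, hp⟩ := K.degenerate_critical i hr hF hF' hH
  rw [K.expMu_eq_iff_normalPart i hr.1 (K.norm_N i hκ), hp, hx, N, smul_smul]
  congr 2
  field_simp

theorem eq_N_of_degenerate (i : Fin K.m) {s r : ℝ} {v p : EuclideanSpace ℝ (Fin n)}
    (hr : K.SubFocal i r) (hv : ‖v‖ = 1) (hp : K.expMu (K.γ i s) (r • v) = p)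
    (hF : K.distRatio i p s = r ^ 2) (hF' : K.distRatioDeriv i p s = 0)
    (hH : K.distRatioHess i p s = 0) : v = K.N i s := by
  obtain ⟨hr0, hκ, -, hx, -⟩ := K.degenerate_critical i hr hF hF' hH
  have hN := K.expMu_N_of_degenerate i hr hF hF' hH
  have hw := K.w_pos i s
  rw [K.expMu_eq_iff_normalPart i hr.1 hv] at hp
  rw [K.expMu_eq_iff_normalPart i hr.1 (K.norm_N i hκ), hp, hx, sub_right_inj] at hN
  exact smul_right_injective _ (show K.w i s * (1 / 2 * K.κ i s * K.w i s * r) * r ≠ 0 by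
    positivity) hN

theorem distRatioHess_eq_zero (i : Fin K.m) {p : EuclideanSpace ℝ (Fin n)} {J : Set ℝ}
    (hJ : J.OrdConnected) (hJi : (interior J).Nonempty)
    (h : ∀ s ∈ J, K.distRatioDeriv i p s = 0) : ∀ s ∈ J, K.distRatioHess i p s = 0 := by
  intro s hs
  have hw := K.w_pos i s
  have := hasDerivAt_eq_zero_of_eq_const hJ hJi hs (K.hasDerivAt_distRatioDeriv i p s) h
  rw [h s hs, div_eq_zero_iff] at this
  rcases this with h1 | h1
  · linarith
  · exact absurd h1 (by positivity)

theorem iteratedDeriv_two_w_neg_of_Del_eq_zero (i : Fin K.m) {s : ℝ} (hκ : 0 < K.κ i s)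
    (hD : K.Del i s = 0) : iteratedDeriv 2 (K.w i) s < 0 := by
  have hw := K.w_pos i s
  rw [Del] at hD
  have : 0 < 1 / 4 * K.κ i s ^ 2 * K.w i s := by positivity
  linarith

/-- A set of parameters where `μ'' < 0` does not cover the component. -/
theorem image_ne_component (i : Fin K.m) {J : Set ℝ}
    (h : ∀ s ∈ J, iteratedDeriv 2 (K.w i) s < 0) : K.γ i '' J ≠ K.component i := by
  intro he
  obtain ⟨s₀, -, hs₀⟩ := isCompact_Icc.exists_isMinOn (s := Set.Icc 0 (K.L i))
    ⟨0, le_rfl, (K.L_pos i).le⟩ (K.continuous_w i).continuousOn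
  have hmem : K.γ i s₀ ∈ K.γ i '' J := he ▸ ⟨s₀, rfl⟩
  obtain ⟨s, hsJ, hs⟩ := hmem
  have hmin : ∀ t, K.w i s ≤ K.w i t := by
    intro t
    obtain ⟨u, hu, hue⟩ := (K.w_periodic i).exists_mem_Ico₀ (K.L_pos i) t
    rw [hue, w, hs]
    exact isMinOn_iff.mp hs₀ u ⟨hu.1, hu.2.le⟩
  have hneg := h s hsJ
  have hlm : IsLocalMin (K.w i) s := Filter.Eventually.of_forall hmin
  have h2 : deriv (deriv (K.w i)) s < 0 := by rwa [(K.hasDerivAt_deriv_w i s).deriv]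
  -- A minimum of μ with μ'' < 0 is also a local maximum, so μ is locally constant and μ'' = 0, a
  -- contradiction.
  have hmax := isLocalMax_of_deriv_deriv_neg h2 hlm.deriv_eq_zero (K.continuous_w i).continuousAt
  have hconst : K.w i =ᶠ[nhds s] fun _ => K.w i s := by
    filter_upwards [hmax] with t ht using le_antisymm ht (hmin t)
  have h3 := hconst.deriv.deriv_eq
  simp at h3
  linarith

end WeightedLink
end

/-! ### Integration of the equations along a critical arc -/

/-- The solutions of `f'' = -(k/2)² f` as phase-shifted cosines. -/
theorem exists_eq_mul_cos {f f' f'' : ℝ → ℝ} {a b k ρ : ℝ} (hk : 0 < k) (hρ : 0 < ρ)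
    (hf : ∀ s, HasDerivAt f (f' s) s) (hf' : ∀ s, HasDerivAt f' (f'' s) s)
    (h : ∀ s ∈ Set.Icc a b, f'' s = -(1 / 4 * k ^ 2 * f s))
    (hE : f a ^ 2 + 4 / k ^ 2 * f' a ^ 2 = ρ ^ 2) :
    ∃ α : ℝ, ∀ s ∈ Set.Icc a b, f s = ρ * Real.cos (k * s / 2 + α) := by
  have harg : ∀ s, HasDerivAt (fun s => k * s / 2) (k / 2) s := fun s => by
    simpa using ((hasDerivAt_id s).const_mul k).div_const 2
  -- Rotating (f, 2f'/k) by the angle ks/2 yields two conserved quantities A and B; their polar form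
  -- supplies amplitude and phase.
  have hc1 := eq_left_of_hasDerivAt_eq_zero (a := a) (b := b)
    (fun s => ((hf s).mul (harg s).cos).sub (((hf' s).const_mul (2 / k)).mul (harg s).sin))
    (fun s hs => by
      rw [h s hs]; field_simp; ring)
  have hc2 := eq_left_of_hasDerivAt_eq_zero (a := a) (b := b)
    (fun s => ((hf s).mul (harg s).sin).add (((hf' s).const_mul (2 / k)).mul (harg s).cos))
    (fun s hs => by
      rw [h s hs]; field_simp; ring)
  simp only [Pi.sub_apply, Pi.mul_apply, Pi.add_apply] at hc1 hc2
  set A := f a * Real.cos (k * a / 2) - 2 / k * f' a * Real.sin (k * a / 2) with hA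
  set B := f a * Real.sin (k * a / 2) + 2 / k * f' a * Real.cos (k * a / 2) with hB
  have hAB : A ^ 2 + B ^ 2 = ρ ^ 2 := by
    rw [← hE, hA, hB]
    have := Real.sin_sq_add_cos_sq (k * a / 2)
    have h1 : 4 / k ^ 2 * f' a ^ 2 = (2 / k * f' a) ^ 2 := by ring
    rw [h1]
    linear_combination (f a ^ 2 + (2 / k * f' a) ^ 2) * this
  have hnorm : ‖(⟨A, B⟩ : ℂ)‖ = ρ := by
    rw [Complex.norm_eq_sqrt_sq_add_sq, hAB, Real.sqrt_sq hρ.le]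
  have hre := Complex.norm_mul_cos_arg ⟨A, B⟩
  have him := Complex.norm_mul_sin_arg ⟨A, B⟩
  rw [hnorm] at hre him
  refine ⟨-Complex.arg ⟨A, B⟩, fun s hs => ?_⟩
  have h1 := hc1 s hs
  have h2 := hc2 s hs
  simp only at hre him
  rw [← sub_eq_add_neg, Real.cos_sub]
  have := Real.sin_sq_add_cos_sq (k * s / 2)
  linear_combination (-f s) * this + Real.cos (k * s / 2) * (h1 - hre)
    + Real.sin (k * s / 2) * (h2 - him)

noncomputable section

namespace WeightedLink

variable {n : ℕ} (K : WeightedLink n)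

/-- An arc with `γ''' = -k² γ'` and curvature `k` is an arc of a circle of radius `1/k`. -/
theorem exists_circle (i : Fin K.m) {a b k : ℝ} (hk : 0 < k)
    (hκ : K.κ i a = k)
    (h : ∀ s ∈ Set.Icc a b, iteratedDeriv 3 (K.γ i) s + k ^ 2 • deriv (K.γ i) s = 0) :
    ∃ c e₁ e₂ : EuclideanSpace ℝ (Fin n), ‖e₁‖ = 1 ∧ ‖e₂‖ = 1 ∧ inner ℝ e₁ e₂ = 0 ∧
      ∀ s ∈ Set.Icc a b, K.γ i s =
        c + (1 / k) • (Real.cos (k * s) • e₁ + Real.sin (k * s) • e₂) := by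
  have h3 : ∀ s ∈ Set.Icc a b, iteratedDeriv 3 (K.γ i) s = -(k ^ 2 • deriv (K.γ i) s) :=
    fun s hs => eq_neg_of_add_eq_zero_left (h s hs)
  have harg : ∀ s, HasDerivAt (fun s => k * s) k s := fun s => by
    simpa using (hasDerivAt_id s).const_mul k
  -- Three conserved vectors: the centre γ + γ''/k², and the frame (-γ''/k, γ') rotated back by the
  -- angle ks.
  have hc := eq_left_of_hasDerivAt_eq_zero (a := a) (b := b)
    (fun s => (K.hasDerivAt_γ i s).add ((K.hasDerivAt_iteratedDeriv_two_γ i s).const_smul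
      (1 / k ^ 2))) (fun s hs => by
      rw [h3 s hs, smul_neg, smul_smul, one_div_mul_cancel (by positivity), one_smul,
        add_neg_cancel])
  have he1 := eq_left_of_hasDerivAt_eq_zero (a := a) (b := b)
    (fun s => (((harg s).cos.const_mul (-1 / k)).smul (K.hasDerivAt_iteratedDeriv_two_γ i s)).sub
      ((harg s).sin.smul (K.hasDerivAt_deriv_γ i s))) (fun s hs => by
      rw [h3 s hs]
      match_scalars <;> field_simp <;> ring)
  have he2 := eq_left_of_hasDerivAt_eq_zero (a := a) (b := b)
    (fun s => (((harg s).sin.const_mul (-1 / k)).smul (K.hasDerivAt_iteratedDeriv_two_γ i s)).add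
      ((harg s).cos.smul (K.hasDerivAt_deriv_γ i s))) (fun s hs => by
      rw [h3 s hs]
      match_scalars <;> field_simp <;> ring)
  simp only [Pi.sub_apply, Pi.smul_apply, Pi.add_apply, Pi.smul_apply'] at hc he1 he2
  have hn2 : inner ℝ (iteratedDeriv 2 (K.γ i) a) (iteratedDeriv 2 (K.γ i) a) = k ^ 2 := by
    rw [real_inner_self_eq_norm_sq, ← hκ]; rfl
  have hn1 := K.inner_deriv_γ_self i a
  have hn0 := K.inner_deriv_γ_iteratedDeriv_two i a
  have hn0' := hn0
  rw [real_inner_comm] at hn0'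
  have hsc := Real.sin_sq_add_cos_sq (k * a)
  refine ⟨K.γ i a + (1 / k ^ 2) • iteratedDeriv 2 (K.γ i) a,
    (-1 / k * Real.cos (k * a)) • iteratedDeriv 2 (K.γ i) a - Real.sin (k * a) • deriv (K.γ i) a,
    (-1 / k * Real.sin (k * a)) • iteratedDeriv 2 (K.γ i) a + Real.cos (k * a) • deriv (K.γ i) a,
    ?_, ?_, ?_, fun s hs => ?_⟩
  rotate_left 3
  · rw [← hc s hs, ← he1 s hs, ← he2 s hs]
    have := Real.sin_sq_add_cos_sq (k * s)
    match_scalars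
    · ring
    · field_simp
      linear_combination this
    · ring
  · rw [← sq_eq_sq₀ (norm_nonneg _) zero_le_one, ← real_inner_self_eq_norm_sq]
    simp only [inner_sub_left, inner_sub_right, real_inner_smul_left, real_inner_smul_right, hn0,
      hn0', hn1, hn2]
    field_simp
    linear_combination k * hsc
  · rw [← sq_eq_sq₀ (norm_nonneg _) zero_le_one, ← real_inner_self_eq_norm_sq]
    simp only [inner_add_left, inner_add_right, real_inner_smul_left, real_inner_smul_right, hn0,
      hn0', hn1, hn2]
    field_simp
    linear_combination k * hsc
  · simp only [inner_sub_left, inner_add_right, real_inner_smul_left, real_inner_smul_right, hn0,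
      hn0', hn1, hn2]
    field_simp
    ring

/-- Along an arc of critical points with common value `r`, curvature is constant, the arc is
circular and the weight is a cosine. -/
theorem critical_arc (i : Fin K.m) {a b r : ℝ} {p : EuclideanSpace ℝ (Fin n)} (hab : a < b)
    (hr : K.SubFocal i r) (hF : ∀ s ∈ Set.Icc a b, K.distRatio i p s = r ^ 2)
    (hF' : ∀ s ∈ Set.Icc a b, K.distRatioDeriv i p s = 0)
    (hH : ∀ s ∈ Set.Icc a b, K.distRatioHess i p s = 0) :
    ∃ κ : ℝ, 0 < κ ∧ (∀ s ∈ Set.Icc a b, K.κ i s = κ) ∧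
      (∀ s ∈ Set.Icc a b,
        deriv (K.w i) s ^ 2 - K.w i s * iteratedDeriv 2 (K.w i) s = 1 / r ^ 2) ∧
      (∀ s ∈ Set.Icc a b, iteratedDeriv 3 (K.γ i) s + κ ^ 2 • deriv (K.γ i) s = 0) ∧
      (∃ α : ℝ, ∀ s ∈ Set.Icc a b, K.w i s = 2 / (κ * r) * Real.cos (κ * s / 2 + α)) := by
  have hdeg := fun s hs => K.degenerate_critical i hr (hF s hs) (hF' s hs) (hH s hs)
  have haI : a ∈ Set.Icc a b := ⟨le_rfl, hab.le⟩
  have hinter : (interior (Set.Icc a b)).Nonempty := by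
    rw [interior_Icc]; exact Set.nonempty_Ioo.mpr hab
  have hr0 := (hdeg a haI).1
  have hw2 : ∀ s ∈ Set.Icc a b,
      iteratedDeriv 2 (K.w i) s = -(1 / 4 * K.κ i s ^ 2 * K.w i s) := fun s hs => by
    have := (hdeg s hs).2.2.1
    rw [Del] at this
    linarith
  have hconserved : ∀ s ∈ Set.Icc a b,
      deriv (K.w i) s ^ 2 + 1 / 4 * K.κ i s ^ 2 * K.w i s ^ 2 = 1 / r ^ 2 := fun s hs => by
    have h1 := (hdeg s hs).2.2.2.1
    have h2 := Real.sq_sqrt (show 0 ≤ 1 - deriv (K.w i) s ^ 2 * r ^ 2 by linarith [(hr.2 s).1])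
    rw [h1] at h2
    rw [eq_div_iff (by positivity)]
    linear_combination h2
  have hwr : ∀ s ∈ Set.Icc a b,
      deriv (K.w i) s ^ 2 - K.w i s * iteratedDeriv 2 (K.w i) s = 1 / r ^ 2 := fun s hs => by
    rw [hw2 s hs, ← hconserved s hs]; ring
  -- Differentiating μ'² - μμ'' = 1/r² gives μ'μ'' = μμ''', so μ''/μ = -κ²/4 is constant.
  have hquot := eq_left_of_hasDerivAt_eq_zero (a := a) (b := b)
    (fun s => (K.hasDerivAt_iteratedDeriv_two_w i s).div (K.hasDerivAt_w i s) (K.w_pos i s).ne')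
    (fun s hs => by
      have h1 := hasDerivAt_eq_zero_of_eq_const Set.ordConnected_Icc hinter hs
        (((K.hasDerivAt_deriv_w i s).pow 2).sub
          ((K.hasDerivAt_w i s).mul (K.hasDerivAt_iteratedDeriv_two_w i s))) hwr
      have : iteratedDeriv 3 (K.w i) s * K.w i s
          - iteratedDeriv 2 (K.w i) s * deriv (K.w i) s = 0 := by
        push_cast at h1
        linear_combination -h1
      simp only [this, zero_div])
  have hκ : ∀ s ∈ Set.Icc a b, K.κ i s = K.κ i a := fun s hs => by
    have h1 := hquot s hs
    simp only [Pi.div_apply] at h1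
    have hws := K.w_pos i s
    have hwa := K.w_pos i a
    rw [hw2 s hs, hw2 a haI, neg_div, neg_div, mul_div_cancel_right₀ _ hws.ne',
      mul_div_cancel_right₀ _ hwa.ne'] at h1
    rw [← sq_eq_sq₀ (K.κ_nonneg i s) (K.κ_nonneg i a)]
    linarith
  have hκ0 := (hdeg a haI).2.1
  refine ⟨K.κ i a, hκ0, hκ, hwr, fun s hs => ?_, ?_⟩
  -- Differentiate p = γ - r²μμ'γ' + ½r²μ²γ''. The γ'' terms cancel, and the relations for μ turn
  -- the rest into ½r²μ²(γ''' + κ²γ').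
  · have h1 := hasDerivAt_eq_zero_of_eq_const Set.ordConnected_Icc hinter hs
      (((K.hasDerivAt_γ i s).sub ((((K.hasDerivAt_w i s).mul_const (r ^ 2)).mul
        (K.hasDerivAt_deriv_w i s)).smul (K.hasDerivAt_deriv_γ i s))).add
        (((((K.hasDerivAt_w i s).pow 2).const_mul (1 / 2)).mul_const (r ^ 2)).smul
          (K.hasDerivAt_iteratedDeriv_two_γ i s)))
      (c := p) (fun t ht => by
        have := (hdeg t ht).2.2.2.2
        rw [sub_eq_iff_eq_add] at this
        simp only [Pi.add_apply, Pi.sub_apply, Pi.smul_apply', Pi.mul_apply, Pi.pow_apply]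
        rw [this]
        abel)
    have hws := K.w_pos i s
    have h2 : (1 / 2 * K.w i s ^ 2 * r ^ 2) •
        (iteratedDeriv 3 (K.γ i) s + K.κ i a ^ 2 • deriv (K.γ i) s) = 0 := by
      rw [← h1]
      have h3 := hconserved s hs
      have h4 := hw2 s hs
      rw [hκ s hs, eq_div_iff (by positivity)] at h3
      rw [hκ s hs] at h4
      simp only [Pi.mul_apply, Pi.pow_apply]
      rw [h4]
      push_cast
      match_scalars
      · ring
      · linear_combination h3
      · ring
    exact (smul_eq_zero_iff_right (by positivity)).mp h2
  · refine exists_eq_mul_cos hκ0 (by positivity) (K.hasDerivAt_w i) (K.hasDerivAt_deriv_w i)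
      (fun s hs => by rw [hw2 s hs, hκ s hs]) ?_
    have h3 := hconserved a haI
    have : (2 / (K.κ i a * r)) ^ 2 = 4 / K.κ i a ^ 2 * (1 / r ^ 2) := by
      field_simp; norm_num
    rw [this, ← h3]
    field_simp
    ring

end WeightedLink
end

/-! ### Existence of the critical arc and the collapsing theorem -/

/-- The derivative of a periodic function is periodic. -/
theorem periodic_of_hasDerivAt {E : Type*} [NormedAddCommGroup E] [NormedSpace ℝ E]
    {f f' : ℝ → E} {c : ℝ} (hf : ∀ s, HasDerivAt f (f' s) s) (h : Function.Periodic f c) :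
    Function.Periodic f' c := fun s => by
  have h1 := (hf (s + c)).comp_add_const s c
  rw [funext h] at h1
  exact h1.unique (hf s)

noncomputable section

namespace WeightedLink

variable {n : ℕ} (K : WeightedLink n)

theorem distRatioDeriv_periodic (i : Fin K.m) (p : EuclideanSpace ℝ (Fin n)) :
    Function.Periodic (K.distRatioDeriv i p) (K.L i) :=
  periodic_of_hasDerivAt (K.hasDerivAt_distRatio i p) (K.distRatio_periodic i p)

theorem iteratedDeriv_two_γ_periodic (i : Fin K.m) :
    Function.Periodic (iteratedDeriv 2 (K.γ i)) (K.L i) :=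
  periodic_of_hasDerivAt (K.hasDerivAt_deriv_γ i)
    (periodic_of_hasDerivAt (K.hasDerivAt_γ i) (K.periodic i))

theorem κ_periodic (i : Fin K.m) : Function.Periodic (K.κ i) (K.L i) := fun s => by
  rw [κ, κ, K.iteratedDeriv_two_γ_periodic i s]

theorem N_periodic (i : Fin K.m) : Function.Periodic (K.N i) (K.L i) := fun s => by
  rw [N, N, K.κ_periodic i s, K.iteratedDeriv_two_γ_periodic i s]

/-- Injectivity of exp^μ on one normal space below the focal radius: the weighted distance
determines r, and the coefficient of r v is nonzero because r|μ'| < 1. -/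
theorem eq_of_expMu_eq (i : Fin K.m) {s r₁ r₂ : ℝ} {v₁ v₂ p : EuclideanSpace ℝ (Fin n)}
    (hr₁ : K.SubFocal i r₁) (hr₂ : K.SubFocal i r₂) (hv₁ : ‖v₁‖ = 1) (hv₂ : ‖v₂‖ = 1)
    (hn₁ : inner ℝ (deriv (K.γ i) s) v₁ = 0) (hn₂ : inner ℝ (deriv (K.γ i) s) v₂ = 0)
    (hp₁ : K.expMu (K.γ i s) (r₁ • v₁) = p) (hp₂ : K.expMu (K.γ i s) (r₂ • v₂) = p) :
    r₁ • v₁ = r₂ • v₂ := by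
  have h1 := (K.distRatio_of_expMu_eq i hr₁ hv₁ hn₁ hp₁).1
  have h2 := (K.distRatio_of_expMu_eq i hr₂ hv₂ hn₂ hp₂).1
  obtain rfl : r₁ = r₂ := (sq_eq_sq₀ hr₁.1 hr₂.1).mp (h1.symm.trans h2)
  rw [K.expMu_eq_iff_normalPart i hr₁.1 hv₁] at hp₁
  rw [K.expMu_eq_iff_normalPart i hr₁.1 hv₂, hp₁, sub_right_inj, mul_smul, mul_smul _ r₁] at hp₂
  have hw := K.w_pos i s
  have hx := Real.sqrt_pos.mpr
    (show 0 < 1 - deriv (K.w i) s ^ 2 * r₁ ^ 2 by linarith [(hr₁.2 s).1])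
  exact smul_right_injective _
    (show K.w i s * √(1 - deriv (K.w i) s ^ 2 * r₁ ^ 2) ≠ 0 by positivity) hp₂

/-- Two critical points of the weighted distance with values below the upper radius bound an arc
of critical points with the same value. -/
theorem exists_critical_arc (i : Fin K.m) {R s₁ s₂ r₁ r₂ : ℝ} {p : EuclideanSpace ℝ (Fin n)}
    (hR₀ : 0 ≤ R) (hR : ENNReal.ofReal R < K.UR) (h₁₂ : s₁ < s₂) (h₂₁ : s₂ < s₁ + K.L i)
    (hr₁ : 0 ≤ r₁) (hr₂ : 0 ≤ r₂) (hr₁R : r₁ ≤ R) (hr₂R : r₂ ≤ R)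
    (hc₁ : K.distRatio i p s₁ = r₁ ^ 2 ∧ K.distRatioDeriv i p s₁ = 0)
    (hc₂ : K.distRatio i p s₂ = r₂ ^ 2 ∧ K.distRatioDeriv i p s₂ = 0) :
    r₁ = r₂ ∧ ∃ a b : ℝ, a < b ∧ (a = s₁ ∧ b = s₂ ∨ a = s₂ - K.L i ∧ b = s₁) ∧
      ∀ s ∈ Set.Icc a b, K.distRatio i p s = r₁ ^ 2 ∧ K.distRatioDeriv i p s = 0 ∧
        K.distRatioHess i p s = 0 := by
  -- A level R' strictly between R and UR leaves room for the openness argument.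
  obtain ⟨R', hR'₀, hRR', hR'⟩ := ENNReal.lt_iff_exists_real_btwn.mp hR
  have hlt : R < R' := (ENNReal.ofReal_lt_ofReal_iff_of_nonneg hR₀).mp hRR'
  have hfoc := K.subFocal_of_lt_focRadMinus hR'₀ (hR'.trans_le (min_le_right _ _)) i
  have hfocR := K.subFocal_of_lt_focRadMinus hR₀ (hR.trans_le (min_le_right _ _)) i
  have hd₁ : K.distRatio i p s₁ ≤ R ^ 2 := hc₁.1 ▸ pow_le_pow_left₀ hr₁ hr₁R 2
  have hd₂ : K.distRatio i p s₂ ≤ R ^ 2 := hc₂.1 ▸ pow_le_pow_left₀ hr₂ hr₂R 2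
  have hper : ∀ s, K.distRatio i p (s - K.L i) = K.distRatio i p s := fun s => by
    rw [← K.distRatio_periodic i p, sub_add_cancel]
  have hper' : ∀ s, K.distRatioDeriv i p (s - K.L i) = K.distRatioDeriv i p s := fun s => by
    rw [← K.distRatioDeriv_periodic i p, sub_add_cancel]
  obtain ⟨a, b, hab, hor, hle⟩ : ∃ a b : ℝ, a < b ∧
      (a = s₁ ∧ b = s₂ ∨ a = s₂ - K.L i ∧ b = s₁) ∧
      ∀ s ∈ Set.Icc a b, K.distRatio i p s ≤ R ^ 2 := by
    rcases K.joined_of_distRatio_le i hR₀ hlt hfoc (hR.trans_le (min_le_left _ _)) h₁₂.le h₂₁.le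
      hd₁ hd₂ with h | h
    · exact ⟨s₁, s₂, h₁₂, Or.inl ⟨rfl, rfl⟩, h.le⟩
    -- The complementary arc runs from s₂ to s₁ + L and is moved back by one period.
    · refine ⟨s₂ - K.L i, s₁, by linarith, Or.inr ⟨rfl, rfl⟩, fun s hs => ?_⟩
      rw [← K.distRatio_periodic i p]
      exact h.le _ ⟨by linarith [hs.1], by linarith [hs.2]⟩
  have hF' : ∀ s ∈ Set.Icc a b, K.distRatioDeriv i p s = 0 := by
    refine K.distRatioDeriv_eq_zero i hfocR hle ?_ ?_ <;>
      rcases hor with ⟨rfl, rfl⟩ | ⟨rfl, rfl⟩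
    · exact hc₁.2
    · rw [hper', hc₂.2]
    · exact hc₂.2
    · exact hc₁.2
  have hFc := eq_left_of_hasDerivAt_eq_zero (K.hasDerivAt_distRatio i p) hF'
  have hbI : b ∈ Set.Icc a b := ⟨hab.le, le_rfl⟩
  have hsq : r₁ ^ 2 = r₂ ^ 2 ∧ K.distRatio i p a = r₁ ^ 2 := by
    have h := hFc b hbI
    rcases hor with ⟨rfl, rfl⟩ | ⟨rfl, rfl⟩
    · exact ⟨by rw [← hc₁.1, ← hc₂.1, h], hc₁.1⟩
    · exact ⟨by rw [← hc₁.1, ← hc₂.1, h, hper], by rw [← h, hc₁.1]⟩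
  have hinter : (interior (Set.Icc a b)).Nonempty := by
    rw [interior_Icc]; exact Set.nonempty_Ioo.mpr hab
  exact ⟨(sq_eq_sq₀ hr₁ hr₂).mp hsq.1, a, b, hab, hor, fun s hs =>
    ⟨(hFc s hs).trans hsq.2, hF' s hs,
      K.distRatioHess_eq_zero i Set.ordConnected_Icc hinter hF' s hs⟩⟩

end WeightedLink
end

theorem theorem2 {n : ℕ} (K : WeightedLink n)
    (q₁ q₂ v₁ v₂ p₀ : EuclideanSpace ℝ (Fin n)) (r₁ r₂ : ℝ)
    (hq₁ : q₁ ∈ K.carrier) (hq₂ : q₂ ∈ K.carrier)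
    (hv₁ : v₁ ∈ K.unitNormals q₁) (hv₂ : v₂ ∈ K.unitNormals q₂)
    (hr₁ : 0 ≤ r₁) (hr₂ : 0 ≤ r₂)
    (hU₁ : ENNReal.ofReal r₁ < K.UR) (hU₂ : ENNReal.ofReal r₂ < K.UR)
    (hp₁ : K.expMu q₁ (r₁ • v₁) = p₀) (hp₂ : K.expMu q₂ (r₂ • v₂) = p₀)
    (hne : (q₁, r₁ • v₁) ≠ (q₂, r₂ • v₂)) :
    q₁ ≠ q₂ ∧ r₁ = r₂ ∧ 0 < r₁ ∧
    ∃ i, q₁ ∈ K.component i ∧ q₂ ∈ K.component i ∧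
      ∀ s₁ s₂ : ℝ, K.γ i s₁ = q₁ → K.γ i s₂ = q₂ → s₁ < s₂ → s₂ < s₁ + K.L i →
        (0 < K.κ i s₁ ∧ v₁ = K.N i s₁) ∧ (0 < K.κ i s₂ ∧ v₂ = K.N i s₂) ∧
        ∃ I : Set ℝ, (I = Set.Icc s₁ s₂ ∨ I = Set.Icc (s₂ - K.L i) s₁) ∧
          (∀ s ∈ I, 0 < K.κ i s ∧ K.expMu (K.γ i s) (r₁ • K.N i s) = p₀) ∧
          (∃ κ : ℝ, 0 < κ ∧ (∀ s ∈ I, K.κ i s = κ) ∧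
            (∀ s ∈ I, deriv (K.w i) s ^ 2 - K.w i s * iteratedDeriv 2 (K.w i) s = 1 / r₁ ^ 2) ∧
            (∀ s ∈ I, iteratedDeriv 3 (K.γ i) s + κ ^ 2 • deriv (K.γ i) s = 0) ∧
            (∃ a : ℝ, ∀ s ∈ I, K.w i s = 2 / (κ * r₁) * Real.cos (κ * s / 2 + a)) ∧
            (∃ c e₁ e₂ : EuclideanSpace ℝ (Fin n), ‖e₁‖ = 1 ∧ ‖e₂‖ = 1 ∧ inner ℝ e₁ e₂ = 0 ∧
              ∀ s ∈ I, K.γ i s =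
                c + (1 / κ) • (Real.cos (κ * s) • e₁ + Real.sin (κ * s) • e₂))) ∧
          (∀ J : Set ℝ, J.OrdConnected → I ⊆ J →
            (∀ s ∈ J, 0 < K.κ i s ∧ K.expMu (K.γ i s) (r₁ • K.N i s) = p₀) →
            K.γ i '' J ≠ K.component i) := by
  obtain ⟨i, t₁, ht₁⟩ := Set.mem_iUnion.mp hq₁
  obtain ⟨j, t₂, ht₂⟩ := Set.mem_iUnion.mp hq₂
  have hf₁ := K.subFocal_of_lt_focRadMinus hr₁ (hU₁.trans_le (min_le_right _ _))
  have hf₂ := K.subFocal_of_lt_focRadMinus hr₂ (hU₂.trans_le (min_le_right _ _))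
  have hR₀ : 0 ≤ max r₁ r₂ := le_max_of_le_left hr₁
  have hR : ENNReal.ofReal (max r₁ r₂) < K.UR := by
    rcases max_choice r₁ r₂ with h | h <;> rw [h] <;> assumption
  have crit₁ : ∀ k s, K.γ k s = q₁ →
      K.distRatio k p₀ s = r₁ ^ 2 ∧ K.distRatioDeriv k p₀ s = 0 := fun k s hs =>
    K.distRatio_of_expMu_eq k (hf₁ k) hv₁.1 (hv₁.2 k s hs) (by rw [hs, hp₁])
  have crit₂ : ∀ k s, K.γ k s = q₂ →
      K.distRatio k p₀ s = r₂ ^ 2 ∧ K.distRatioDeriv k p₀ s = 0 := fun k s hs =>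
    K.distRatio_of_expMu_eq k (hf₂ k) hv₂.1 (hv₂.2 k s hs) (by rw [hs, hp₂])
  have hqne : q₁ ≠ q₂ := by
    rintro rfl
    refine hne (Prod.ext rfl ?_)
    exact K.eq_of_expMu_eq i (hf₁ i) (hf₂ i) hv₁.1 hv₂.1 (hv₁.2 i t₁ ht₁) (hv₂.2 i t₁ ht₁)
      (by rw [ht₁, hp₁]) (by rw [ht₁, hp₂])
  obtain rfl : i = j := by
    refine K.eq_of_Sig_le hR₀ (hR.trans_le (min_le_left _ _)) (K.Sig_le_of_distRatio_le hR₀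
      (p := p₀) (s := t₁) (t := t₂) ?_ ?_)
    · rw [(crit₁ i t₁ ht₁).1]; exact pow_le_pow_left₀ hr₁ (le_max_left _ _) 2
    · rw [(crit₂ j t₂ ht₂).1]; exact pow_le_pow_left₀ hr₂ (le_max_right _ _) 2
  have harc : ∀ s₁ s₂, K.γ i s₁ = q₁ → K.γ i s₂ = q₂ → s₁ < s₂ → s₂ < s₁ + K.L i → _ :=
    fun s₁ s₂ h₁ h₂ h₁₂ h₂₁ => K.exists_critical_arc i hR₀ hR h₁₂ h₂₁ hr₁ hr₂ (le_max_left _ _)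
      (le_max_right _ _) (crit₁ i s₁ h₁) (crit₂ i s₂ h₂)
  -- The equality and positivity of the radii are needed before any parameters are prescribed, so t₂
  -- is moved into the period starting at t₁.
  obtain ⟨u, hu, hue⟩ := (K.periodic i).exists_mem_Ico (K.L_pos i) t₂ t₁
  have hut : t₁ < u := lt_of_le_of_ne hu.1 (by rintro rfl; exact hqne (by rw [← ht₁, ← ht₂, hue]))
  obtain ⟨hrr, a, b, hab, -, hI⟩ := harc t₁ u ht₁ (by rw [← hue, ht₂]) hut hu.2
  have haI := hI a ⟨le_rfl, hab.le⟩
  refine ⟨hqne, hrr, (K.degenerate_critical i (hf₁ i) haI.1 haI.2.1 haI.2.2).1, i, ⟨t₁, ht₁⟩,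
    ⟨t₂, ht₂⟩, ?_⟩
  clear! a b u
  subst hrr
  intro s₁ s₂ h₁ h₂ h₁₂ h₂₁
  obtain ⟨-, a, b, hab, hor, hI⟩ := harc s₁ s₂ h₁ h₂ h₁₂ h₂₁
  have hdeg := fun s hs =>
    K.degenerate_critical i (hf₁ i) (hI s hs).1 (hI s hs).2.1 (hI s hs).2.2
  have hN : ∀ s ∈ Set.Icc a b, ∀ v : EuclideanSpace ℝ (Fin n), ‖v‖ = 1 →
      K.expMu (K.γ i s) (r₁ • v) = p₀ → 0 < K.κ i s ∧ v = K.N i s := fun s hs v hv hp =>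
    ⟨(hdeg s hs).2.1,
      K.eq_N_of_degenerate i (hf₁ i) hv hp (hI s hs).1 (hI s hs).2.1 (hI s hs).2.2⟩
  have haI : a ∈ Set.Icc a b := ⟨le_rfl, hab.le⟩
  have hbI : b ∈ Set.Icc a b := ⟨hab.le, le_rfl⟩
  have hends : (0 < K.κ i s₁ ∧ v₁ = K.N i s₁) ∧ (0 < K.κ i s₂ ∧ v₂ = K.N i s₂) := by
    rcases hor with ⟨rfl, rfl⟩ | ⟨rfl, rfl⟩
    · exact ⟨hN _ haI v₁ hv₁.1 (by rw [h₁, hp₁]), hN _ hbI v₂ hv₂.1 (by rw [h₂, hp₂])⟩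
    · have h := hN _ haI v₂ hv₂.1 (by rw [(K.periodic i).sub_eq, h₂, hp₂])
      rw [(K.κ_periodic i).sub_eq, (K.N_periodic i).sub_eq] at h
      exact ⟨hN _ hbI v₁ hv₁.1 (by rw [h₁, hp₁]), h⟩
  refine ⟨hends.1, hends.2, Set.Icc a b, ?_, fun s hs => ⟨(hdeg s hs).2.1,
    K.expMu_N_of_degenerate i (hf₁ i) (hI s hs).1 (hI s hs).2.1 (hI s hs).2.2⟩, ?_, ?_⟩
  · rcases hor with ⟨rfl, rfl⟩ | ⟨rfl, rfl⟩
    · exact Or.inl rfl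
    · exact Or.inr rfl
  · obtain ⟨k, hk, hκ, hw, hγ, hcos⟩ := K.critical_arc i hab (hf₁ i) (fun s hs => (hI s hs).1)
      (fun s hs => (hI s hs).2.1) (fun s hs => (hI s hs).2.2)
    exact ⟨k, hk, hκ, hw, hγ, hcos, K.exists_circle i hk (hκ a haI) hγ⟩
  · intro J hJ hIJ hJp
    have hcrit := fun s hs => K.distRatio_of_expMu_eq i (hf₁ i) (K.norm_N i (hJp s hs).1)
      (K.inner_deriv_γ_N i s) (hJp s hs).2
    -- Because J contains a nondegenerate interval, vanishing of F' on J forces the Hessian to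
    -- vanish at every point of J, end points included.
    have hinter : (interior J).Nonempty := by
      refine Set.Nonempty.mono (interior_mono hIJ) ?_
      rw [interior_Icc]
      exact Set.nonempty_Ioo.mpr hab
    have hH := K.distRatioHess_eq_zero i hJ hinter fun s hs => (hcrit s hs).2
    exact K.image_ne_component i fun s hs => K.iteratedDeriv_two_w_neg_of_Del_eq_zero i
      (hJp s hs).1 (K.degenerate_critical i (hf₁ i) (hcrit s hs).1 (hcrit s hs).2 (hH s hs)).2.2.1
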